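/- **Setting.** Let $n\ge 2$. Consider the system with states $x\in\mathbb R^{p}$, $z_i\in\mathbb R^{p_i}$ $(i\in[n])$, input $u\in\mathbb R^{q}$ and unknown disturbances $d_i$, $$\dot x=f_0(x)+g_0(x)z_1,\qquad \dot z_i=f_i(x,z_1,\dots,z_i)+g_i(x,z_1,\dots,z_i)z_{i+1}+d_i\quad(i\in[n]),\qquad z_{n+1}:=u,$$ where $f_0,\dots,f_n,g_0,\dots,g_n$ are known functions of class $C^{n+1}$, and the safe set $\mathcal C=\{x: h(x)\ge 0\}$ with $h:\mathbb R^p\to\mathbb R$ of class $C^{n+1}$. The functions $\dot d_i$ exist and are bounded (by unknown constants). For every $i\in[n]$, $x\in\mathcal C$ and $z_1,\dots,z_i$, the matrix $g_i(x,z_1,\dots,z_i)$ has a right inverse, and $g_i^\dagger=g_i^\top(g_ig_i^\top)^{-1}$. Let $\rho$ be a smooth function, positive on $[0,\infty)$ and bounded there together with its derivatives up to order $n$. For vectors and matrices, $\|\cdot\|$ is the entrywise 2-norm. **Proxy control.** Let $\dot\mu_i=\mu_{i+1}$ $(i\in[n])$ with $\mu_{n+1}:=\nu\in\mathbb R^{p_1}$,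 $\mu_1(0)=z_1(0)$, $\mu_i(0)=0$ for $i=2,\dots,n$, and put $e=z_1-\mu_1$. Let $\chi:\mathbb R\to\mathbb R$ be $n+1$ times differentiable with $\chi(0)=0$, $\chi=1$ on $[1,\infty)$ and $\chi'>0$ on $(-\infty,1)$; let $\xi,\lambda_1,\dots,\lambda_{n+1},\beta_1,\dots,\beta_n>0$; put $y_j=\chi^{(j)}(h(x)/\xi)$, $0\le j\le n+1$. Define $b_0=y_0$ and, treating $x$, $\mu_j$, $y_j$, $t$ as independent variables in the partial derivatives, $$\mathcal M_i=\frac1\xi\sum_{j=0}^{i-1}\frac{\partial b_{i-1}}{\partial y_j}\frac{\partial h}{\partial x}y_{j+1}+\frac{\partial b_{i-1}}{\partial x}\quad(i\in[n+1]),$$ $$b_i=\mathcal M_i(f_0+g_0\mu_1)-\frac{\|\mathcal M_ig_0\|^2}{2\beta_i}-\frac{\beta_i}{2}\rho^2+\lambda_ib_{i-1}+\frac{\partial b_{i-1}}{\partial t}+\sum_{j=1}^{i-1}\frac{\partial b_{i-1}}{\partial\mu_j}\mu_{j+1}\quad(i\in[n]),$$ $$\psi_0=\frac{\partial b_n}{\partial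 t}+\sum_{j=1}^{n-1}\frac{\partial b_n}{\partial\mu_j}\mu_{j+1}+\mathcal M_{n+1}(f_0+g_0\mu_1)+\lambda_{n+1}b_n-\|\mathcal M_{n+1}g_0\|\rho,\qquad \psi_1=\frac{\partial b_n}{\partial\mu_n}.$$ Assume: (i) for $x\in\mathcal C$, $\frac{\partial h}{\partial x}g_0(x)=0$ implies $h(x)\ge\xi$; (ii) $\sum_{j=2}^{n+1}\frac{\beta_{j-1}}2\left(\frac{d}{dt}+\lambda_j\right)\circ\cdots\circ\left(\frac{d}{dt}+\lambda_{n+1}\right)\rho^2\le\prod_{j=1}^{n+1}\lambda_j$ for all $t\ge0$; (iii) at the initial values and $t=0$, $y_0>0$ and $b_i>0$ for all $i\in[n]$. The control $\nu$ is a locally Lipschitz feedback which, whenever $x\in\mathcal C$, minimizes $\|\nu-\nu_d\|^2$ subject to $\psi_0+\psi_1\nu\ge0$, where $\nu_d$ is any nominal control. **Observer and filters.** With $\alpha_i>0$ $(i\in[n])$ and $T_{i,j}>0$ $(i\in[n-1],\ j\in[n-i])$, and arbitrary initial values, let $$\hat d_i=s_i+\alpha_iz_i,\quad \dot s_i=-\alpha_i(f_i+g_iz_{i+1}+\hat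 d_i)\ (i\in[n]),\qquad \dot{\hat d}{}^f_{i,j}=-T_{i,j}(\hat d^f_{i,j}-\hat d^f_{i,j-1}),\quad \hat d^f_{i,0}=\hat d_i .$$ **Controller.** Let $k_i>0$ $(i\in[n])$, $0<\sigma_i<\gamma_i^f$ $(i\in[n-1])$, $0<\nu_n<2\alpha_n$, $\kappa_n=\alpha_n-\nu_n/2$, $0<\sigma_n<\kappa_n$. Put $\epsilon_1=e$, $\epsilon_i=z_i-\tau_{i-1}$ $(2\le i\le n)$, $l_2=e/(\rho^2-\|e\|^2)$, $l_i=\epsilon_{i-1}$ $(3\le i\le n)$, and $$\tau_1=g_1^\dagger\Big[\frac{\dot\rho}{\rho}e-k_1e-\hat d^f_{1,n-1}-\frac{n\,e}{4(\gamma_1^f-\sigma_1)(\rho^2-\|e\|^2)}-f_1+\mu_2\Big],$$ $$\tau_i=g_i^\dagger\Big[\sum_{j=1}^{i-1}\frac{\partial\tau_{i-1}}{\partial z_j}\hat d^f_{j,n-j}-\sum_{j=1}^{i-1}\frac{(n-j+1)\epsilon_i}{4\gamma_j^f}\Big\|\frac{\partial\tau_{i-1}}{\partial z_j}\Big\|^2-\hat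 d^f_{i,n-i}-f_i-\frac{(n-i+1)\epsilon_i}{4(\gamma_i^f-\sigma_i)}-k_i\epsilon_i-g_{i-1}^\top l_i+\mathcal N_i\Big]\quad(2\le i\le n-1),$$ $$u=g_n^\dagger\Big[\sum_{j=1}^{n-1}\frac{\partial\tau_{n-1}}{\partial z_j}\hat d^f_{j,n-j}-\sum_{j=1}^{n-1}\frac{(n-j+1)\epsilon_n}{4\gamma_j^f}\Big\|\frac{\partial\tau_{n-1}}{\partial z_j}\Big\|^2-\hat d_n-f_n-\frac{\epsilon_n}{4(\kappa_n-\sigma_n)}-k_n\epsilon_n-g_{n-1}^\top l_n+\mathcal N_n\Big],$$ where, for $2\le i\le n$, $$\mathcal N_i=\frac{\partial\tau_{i-1}}{\partial t}+\sum_{j=1}^{i-1}\frac{\partial\tau_{i-1}}{\partial z_j}(f_j+g_jz_{j+1})+\sum_{j=1}^{i}\frac{\partial\tau_{i-1}}{\partial\mu_j}\mu_{j+1}-\sum_{j=1}^{i-1}\sum_{m=j}^{i-1}\frac{\partial\tau_{i-1}}{\partial\hat d^f_{j,n-m}}T_{j,n-m}(\hat d^f_{j,n-m}-\hat d^f_{j,n-m-1})+\frac{\partial\tau_{i-1}}{\partial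 x}(f_0+g_0z_1).$$ **Theorem.** Under these assumptions, along every solution of the closed-loop system on a time interval $[0,T)$ with $0<T\le\infty$, one has $\|e(t)\|\le\rho(t)$ and $h(x(t))\ge0$ for all $t\in[0,T)$. -/

import Mathlib

open scoped ContDiff

noncomputable section

namespace PCBF

/-- `ℝ^m` with the 2-norm. -/
abbrev Vec (m : ℕ) : Type := EuclideanSpace ℝ (Fin m)

/-- The pseudo-inverse `A† = Aᵀ (A Aᵀ)⁻¹`; it is a right inverse of `A` as soon as `A` has one. -/
def rightInv {a b : ℕ} (A : Vec a →L[ℝ] Vec b) : Vec b →L[ℝ] Vec a :=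
  (ContinuousLinearMap.adjoint A) ∘L (A ∘L ContinuousLinearMap.adjoint A).inverse

/-- The square of the (entrywise) 2-norm of the matrix of `A`. -/
def frobSq {a b : ℕ} (A : Vec a →L[ℝ] Vec b) : ℝ :=
  ∑ i : Fin a, ‖A (EuclideanSpace.single i 1)‖ ^ 2

/-- Entry `i` (counted from `0`) of a finite family, with value `0` out of range. -/
def nth {m : ℕ} {X : Type*} [Zero X] (a : Fin m → X) (i : ℕ) : X :=
  if h : i < m then a ⟨i, h⟩ else 0

/-- The known functions of the strict-feedback system and the function `h` of the safe set.
`p 0` is the dimension of `x`, `p k` that of `z_k` for `1 ≤ k ≤ n`, and `p (n + 1)` that of `u`.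
The arguments of `f k`, `g k` are `x, z_1, …, z_k`; only `1 ≤ k ≤ n` is used. -/
structure Plant (p : ℕ → ℕ) where
  f₀ : Vec (p 0) → Vec (p 0)
  g₀ : Vec (p 0) → Vec (p 1) →L[ℝ] Vec (p 0)
  f : (k : ℕ) → ((j : Fin (k + 1)) → Vec (p j)) → Vec (p k)
  g : (k : ℕ) → ((j : Fin (k + 1)) → Vec (p j)) → Vec (p (k + 1)) →L[ℝ] Vec (p k)
  h : Vec (p 0) → ℝ

/-- The safe set. -/
def Plant.safeSet {p : ℕ → ℕ} (S : Plant p) : Set (Vec (p 0)) := {x | 0 ≤ S.h x}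

/-- All functions are of class `C^(n+1)`. -/
def Plant.IsSmooth {p : ℕ → ℕ} (S : Plant p) (n : ℕ) : Prop :=
  ContDiff ℝ (n + 1) S.f₀ ∧ ContDiff ℝ (n + 1) S.g₀ ∧ ContDiff ℝ (n + 1) S.h ∧
    ∀ k, 1 ≤ k → k ≤ n → ContDiff ℝ (n + 1) (S.f k) ∧ ContDiff ℝ (n + 1) (S.g k)

/-- `g_k` has a right inverse at every `x` in the safe set and all `z_1, …, z_k`, `1 ≤ k ≤ n`. -/
def Plant.HasRightInverses {p : ℕ → ℕ} (S : Plant p) (n : ℕ) : Prop :=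
  ∀ k, 1 ≤ k → k ≤ n → ∀ a : (j : Fin (k + 1)) → Vec (p j), a 0 ∈ S.safeSet →
    ∃ r : Vec (p k) →L[ℝ] Vec (p (k + 1)), S.g k a ∘L r = ContinuousLinearMap.id ℝ (Vec (p k))

/-- Design functions and parameters, indexed as in the mathematical text (from `1`). -/
structure Design where
  /-- performance bound -/
  ρ : ℝ → ℝ
  /-- saturation function of the barrier construction -/
  χ : ℝ → ℝ
  ξ : ℝ
  lam : ℕ → ℝ
  β : ℕ → ℝ
  /-- gains of the disturbance observer -/
  α : ℕ → ℝ
  /-- gains `T i j` of the low-pass filters -/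
  T : ℕ → ℕ → ℝ
  /-- backstepping gains -/
  k : ℕ → ℝ
  /-- `γ i` for `1 ≤ i ≤ n - 1` -/
  γ : ℕ → ℝ
  /-- `σ i` for `1 ≤ i ≤ n` -/
  σ : ℕ → ℝ
  /-- the constant `ν_n` in `κ_n = α_n - ν_n / 2` -/
  nuN : ℝ

/-- The constant `κ_n`. -/
def Design.kappa (D : Design) (n : ℕ) : ℝ := D.α n - D.nuN / 2

/-- `ρ` is positive and smooth, and `ρ` and its derivatives up to order `n` are bounded, on
`[0, ∞)`. -/
def Design.PerformanceBound (D : Design) (n : ℕ) : Prop :=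
  ContDiff ℝ ∞ D.ρ ∧ (∀ t, 0 ≤ t → 0 < D.ρ t) ∧
    ∀ i ≤ n, ∃ B : ℝ, ∀ t, 0 ≤ t → |iteratedDeriv i D.ρ t| ≤ B

/-- `χ` is `(n+1)` times differentiable, `χ 0 = 0`, `χ = 1` on `[1, ∞)`, `χ' > 0` on `(-∞, 1)`. -/
def Design.Saturation (D : Design) (n : ℕ) : Prop :=
  (∀ i ≤ n, Differentiable ℝ (iteratedDeriv i D.χ)) ∧ D.χ 0 = 0 ∧ (∀ r, 1 ≤ r → D.χ r = 1) ∧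
    ∀ r, r < 1 → 0 < deriv D.χ r

/-- Sign conditions on the parameters of the tracking controller, the observer and the filters. -/
def Design.TrackingGains (D : Design) (n : ℕ) : Prop :=
  (∀ i, 1 ≤ i → i ≤ n → 0 < D.α i ∧ 0 < D.k i) ∧
  (∀ i j, 1 ≤ i → i ≤ n - 1 → 1 ≤ j → j ≤ n - i → 0 < D.T i j) ∧
  (∀ i, 1 ≤ i → i ≤ n - 1 → 0 < D.γ i ∧ 0 < D.σ i ∧ D.σ i < D.γ i) ∧
  0 < D.nuN ∧ D.nuN < 2 * D.α n ∧ 0 < D.σ n ∧ D.σ n < D.kappa n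

section Proxy

variable {n : ℕ} {p : ℕ → ℕ}

/-- Functions of the independent variables `x`, `μ = (μ_1, …, μ_n)`, `y = (y_0, …, y_{n+1})`, `t`. -/
abbrev ProxyFun (n : ℕ) (p : ℕ → ℕ) : Type :=
  Vec (p 0) → (Fin n → Vec (p 1)) → (Fin (n + 2) → ℝ) → ℝ → ℝ

/-- `(1/ξ) ∑_{j=0}^{i} ∂b/∂y_j ∂h/∂x y_{j+1} + ∂b/∂x`; for `b = b_i` this is `M_{i+1}`. -/
def mRow (S : Plant p) (D : Design) (i : ℕ) (b : ProxyFun n p) (x : Vec (p 0))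
    (μ : Fin n → Vec (p 1)) (y : Fin (n + 2) → ℝ) (t : ℝ) : Vec (p 0) →L[ℝ] ℝ :=
  (1 / D.ξ) • (∑ j : Fin (n + 2) with j.val ≤ i,
      (deriv (fun r => b x μ (Function.update y j r) t) (y j) * nth y (j + 1)) • fderiv ℝ S.h x)
    + fderiv ℝ (fun x' => b x' μ y t) x

/-- `∂b/∂μ_{j+1}`, a row vector. -/
def dMuProxy (b : ProxyFun n p) (x : Vec (p 0)) (μ : Fin n → Vec (p 1)) (y : Fin (n + 2) → ℝ)
    (t : ℝ) (j : Fin n) : Vec (p 1) →L[ℝ] ℝ :=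
  fderiv ℝ (fun w => b x (Function.update μ j w) y t) (μ j)

/-- The functions `b_i`. -/
def bFun (S : Plant p) (D : Design) : ℕ → ProxyFun n p
  | 0 => fun _ _ y _ => y 0
  | i + 1 => fun x μ y t =>
      mRow S D i (bFun S D i) x μ y t (S.f₀ x + S.g₀ x (nth μ 0))
        - ‖mRow S D i (bFun S D i) x μ y t ∘L S.g₀ x‖ ^ 2 / (2 * D.β (i + 1))
        - D.β (i + 1) / 2 * D.ρ t ^ 2
        + D.lam (i + 1) * bFun S D i x μ y t
        + deriv (fun t' => bFun S D i x μ y t') t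
        + ∑ j : Fin n with j.val < i, dMuProxy (bFun S D i) x μ y t j (nth μ (j + 1))

/-- `y_j = χ^{(j)}(h(x)/ξ)`. -/
def yVal (n : ℕ) (S : Plant p) (D : Design) (x : Vec (p 0)) : Fin (n + 2) → ℝ :=
  fun j => iteratedDeriv j D.χ (S.h x / D.ξ)

/-- `ψ_0`. -/
def psi0 (S : Plant p) (D : Design) (x : Vec (p 0)) (μ : Fin n → Vec (p 1)) (t : ℝ) : ℝ :=
  deriv (fun t' => bFun S D n x μ (yVal n S D x) t') t
    + ∑ j : Fin n with j.val + 1 < n,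
        dMuProxy (bFun S D n) x μ (yVal n S D x) t j (nth μ (j + 1))
    + mRow S D n (bFun S D n) x μ (yVal n S D x) t (S.f₀ x + S.g₀ x (nth μ 0))
    + D.lam (n + 1) * bFun S D n x μ (yVal n S D x) t
    - ‖mRow S D n (bFun S D n) x μ (yVal n S D x) t ∘L S.g₀ x‖ * D.ρ t

/-- `ψ_1 = ∂b_n/∂μ_n`. -/
def psi1 (S : Plant p) (D : Design) (x : Vec (p 0)) (μ : Fin n → Vec (p 1)) (t : ℝ) :
    Vec (p 1) →L[ℝ] ℝ :=
  if hn : 0 < n then dMuProxy (bFun S D n) x μ (yVal n S D x) t ⟨n - 1, by omega⟩ else 0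

/-- The set `K_BF`. -/
def KBF (S : Plant p) (D : Design) (x : Vec (p 0)) (μ : Fin n → Vec (p 1)) (t : ℝ) :
    Set (Vec (p 1)) :=
  {w | 0 ≤ psi0 S D x μ t + psi1 S D x μ t w}

/-- `(d/dt + lam_j) ∘ (d/dt + lam_{j+1}) ∘ ⋯ ∘ (d/dt + lam_{j+l-1})` applied to `F`. -/
def shiftChain (lam : ℕ → ℝ) : (l j : ℕ) → (ℝ → ℝ) → ℝ → ℝ
  | 0, _, F => F
  | l + 1, j, F => fun t =>
      deriv (shiftChain lam l (j + 1) F) t + lam j * shiftChain lam l (j + 1) F t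

/-- The conditions on `ξ`, `λ_i`, `β_i`, the barrier function and the initial values that make the
proxy design work. -/
structure ProxyConditions (n : ℕ) (S : Plant p) (D : Design) (x₀ : Vec (p 0))
    (μ₀ : Fin n → Vec (p 1)) : Prop where
  xi_pos : 0 < D.ξ
  lam_pos : ∀ i, 1 ≤ i → i ≤ n + 1 → 0 < D.lam i
  beta_pos : ∀ i, 1 ≤ i → i ≤ n → 0 < D.β i
  relDegree : ∀ x ∈ S.safeSet, fderiv ℝ S.h x ∘L S.g₀ x = 0 → D.ξ ≤ S.h x
  rate : ∀ t, 0 ≤ t →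
    ∑ j ∈ Finset.Icc 2 (n + 1),
        D.β (j - 1) / 2 * shiftChain D.lam (n + 2 - j) j (fun s => D.ρ s ^ 2) t
      ≤ ∏ j ∈ Finset.Icc 1 (n + 1), D.lam j
  init_zero : 0 < yVal n S D x₀ 0
  init : ∀ i, 1 ≤ i → i ≤ n → 0 < bFun S D i x₀ μ₀ (yVal n S D x₀) 0

end Proxy

/-- State of the closed loop: `x`, `(z_i)`, `(μ_i)`, the observer states `(s_i)`, `1 ≤ i ≤ n`, and
the filter states `d̂^f_{i,j}`, `1 ≤ j ≤ n - i` (all index ranges are shifted to start at `0`). -/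
abbrev State (n : ℕ) (p : ℕ → ℕ) : Type :=
  Vec (p 0) × ((i : Fin n) → Vec (p (i + 1))) × (Fin n → Vec (p 1)) ×
    ((i : Fin n) → Vec (p (i + 1))) × ((i : Fin n) → Fin (n - 1 - i) → Vec (p (i + 1)))

namespace State

variable {n : ℕ} {p : ℕ → ℕ}

def x (v : State n p) : Vec (p 0) := v.1
def z (v : State n p) : (i : Fin n) → Vec (p (i + 1)) := v.2.1
def mu (v : State n p) : Fin n → Vec (p 1) := v.2.2.1
def s (v : State n p) : (i : Fin n) → Vec (p (i + 1)) := v.2.2.2.1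
def filt (v : State n p) : (i : Fin n) → Fin (n - 1 - i) → Vec (p (i + 1)) := v.2.2.2.2

def setX (v : State n p) (w : Vec (p 0)) : State n p := (w, v.z, v.mu, v.s, v.filt)
def setZ (v : State n p) (i : Fin n) (w : Vec (p (i + 1))) : State n p :=
  (v.x, Function.update v.z i w, v.mu, v.s, v.filt)
def setMu (v : State n p) (i : Fin n) (w : Vec (p 1)) : State n p :=
  (v.x, v.z, Function.update v.mu i w, v.s, v.filt)
def setFilt (v : State n p) (i : Fin n) (j : Fin (n - 1 - i)) (w : Vec (p (i + 1))) : State n p :=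
  (v.x, v.z, v.mu, v.s, Function.update v.filt i (Function.update (v.filt i) j w))

/-- `x` for `k = 0`, and `z_k` for `1 ≤ k ≤ n`. -/
def Z (v : State n p) : (k : ℕ) → Vec (p k)
  | 0 => v.x
  | k + 1 => if h : k < n then v.z ⟨k, h⟩ else 0

/-- `(x, z_1, …, z_k)`. -/
def upTo (v : State n p) (k : ℕ) : (j : Fin (k + 1)) → Vec (p j) := fun j => v.Z j

/-- The virtual tracking error `e = z_1 - μ_1`. -/
def err (v : State n p) : Vec (p 1) := v.Z 1 - nth v.mu 0

/-- `μ_{i+1}`, where `μ_{n+1} = w` is the value of the proxy control. -/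
def chain (v : State n p) (w : Vec (p 1)) (i : ℕ) : Vec (p 1) :=
  if h : i < n then v.mu ⟨i, h⟩ else w

/-- `d̂^f_{k,j}`, where `d̂^f_{k,0} = d̂_k = s_k + α_k z_k` is the observer output. -/
def dHat (D : Design) (v : State n p) : (k j : ℕ) → Vec (p k)
  | 0, _ => 0
  | k + 1, 0 => if h : k < n then v.s ⟨k, h⟩ + D.α (k + 1) • v.z ⟨k, h⟩ else 0
  | k + 1, j + 1 => if h : j < n - 1 - k then v.filt ⟨k, by omega⟩ ⟨j, h⟩ else 0

end State

section Controller

variable {n : ℕ} {p : ℕ → ℕ} {m : ℕ}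

/-- `∂F/∂x`. -/
def dX (F : State n p → ℝ → Vec m) (v : State n p) (t : ℝ) : Vec (p 0) →L[ℝ] Vec m :=
  fderiv ℝ (fun w => F (v.setX w) t) v.x

/-- `∂F/∂z_{j+1}`. -/
def dZ (F : State n p → ℝ → Vec m) (v : State n p) (t : ℝ) (j : Fin n) :
    Vec (p (j + 1)) →L[ℝ] Vec m :=
  fderiv ℝ (fun w => F (v.setZ j w) t) (v.z j)

/-- `∂F/∂μ_{j+1}`. -/
def dMu (F : State n p → ℝ → Vec m) (v : State n p) (t : ℝ) (j : Fin n) :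
    Vec (p 1) →L[ℝ] Vec m :=
  fderiv ℝ (fun w => F (v.setMu j w) t) (v.mu j)

/-- `∂F/∂d̂^f_{j+1,l+1}`. -/
def dFilt (F : State n p → ℝ → Vec m) (v : State n p) (t : ℝ) (j : Fin n) (l : Fin (n - 1 - j)) :
    Vec (p (j + 1)) →L[ℝ] Vec m :=
  fderiv ℝ (fun w => F (v.setFilt j l w) t) (v.filt j l)

/-- The term `𝒩_i` belonging to `τ = τ_{i-1}`; `w` is the value of the proxy control, which enters
only for `i = n`. -/
def nTerm (S : Plant p) (D : Design) (w : Vec (p 1)) (i : ℕ) (τ : State n p → ℝ → Vec m)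
    (v : State n p) (t : ℝ) : Vec m :=
  deriv (fun t' => τ v t') t
    + ∑ j : Fin n with j.val + 1 < i,
        dZ τ v t j (S.f (j + 1) (v.upTo (j + 1)) + S.g (j + 1) (v.upTo (j + 1)) (v.Z (j + 2)))
    + ∑ j : Fin n with j.val < i, dMu τ v t j (v.chain w (j + 1))
    - ∑ j : Fin n with j.val + 1 < i, ∑ l : Fin (n - 1 - j) with n < l.val + 1 + i,
        dFilt τ v t j l
          (D.T (j + 1) (l + 1) • (v.dHat D (j + 1) (l + 1) - v.dHat D (j + 1) l))
    + dX τ v t (S.f₀ v.x + S.g₀ v.x (v.Z 1))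

/-- `γ_i - σ_i` for `i < n`, and `κ_n - σ_n` for `i = n`. -/
def Design.margin (D : Design) (n i : ℕ) : ℝ :=
  if i = n then D.kappa n - D.σ n else D.γ i - D.σ i

/-- The control laws: `τ_k` for `1 ≤ k ≤ n - 1` is the `k`-th virtual control, and `τ_n` is the
control `u`. The convention `τ_0 = μ_1` gives `ε_k = z_k - τ_{k-1}` for all `k ≥ 1`, in particular
`ε_1 = e`. The argument `w` is the value of the proxy control; it enters only in `τ_n`. -/
def tau (S : Plant p) (D : Design) (w : Vec (p 1)) : (k : ℕ) → State n p → ℝ → Vec (p (k + 1))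
  | 0 => fun v _ => nth v.mu 0
  | 1 => fun v t =>
      rightInv (S.g 1 (v.upTo 1))
        ((deriv D.ρ t / D.ρ t) • v.err - D.k 1 • v.err - v.dHat D 1 (n - 1)
          - ((n : ℝ) / (4 * D.margin n 1 * (D.ρ t ^ 2 - ‖v.err‖ ^ 2))) • v.err
          - S.f 1 (v.upTo 1) + v.chain w 1)
  | k + 2 => fun v t =>
      let τ := tau S D w (k + 1)
      let ε : Vec (p (k + 2)) := v.Z (k + 2) - τ v t
      let ε' : Vec (p (k + 1)) := v.Z (k + 1) - tau S D w k v t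
      let l : Vec (p (k + 1)) := if k = 0 then (1 / (D.ρ t ^ 2 - ‖ε'‖ ^ 2)) • ε' else ε'
      rightInv (S.g (k + 2) (v.upTo (k + 2)))
        (∑ j : Fin n with j.val + 1 < k + 2, dZ τ v t j (v.dHat D (j + 1) (n - (j + 1)))
          - ∑ j : Fin n with j.val + 1 < k + 2,
              (((n : ℝ) - ((j : ℝ) + 1) + 1) / (4 * D.γ (j + 1)) * frobSq (dZ τ v t j)) • ε
          - v.dHat D (k + 2) (n - (k + 2))
          - S.f (k + 2) (v.upTo (k + 2))
          - (((n : ℝ) - ((k : ℝ) + 2) + 1) / (4 * D.margin n (k + 2))) • ε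
          - D.k (k + 2) • ε
          - ContinuousLinearMap.adjoint (S.g (k + 1) (v.upTo (k + 1))) l
          + nTerm S D w (k + 2) τ v t)

/-- The signal driving the `k`-th equation: `z_{k+1}` for `k < n`, and `u` for `k = n`. -/
def stageInput (S : Plant p) (D : Design) (w : Vec (p 1)) (v : State n p) (t : ℝ) (k : ℕ) :
    Vec (p (k + 1)) :=
  if k < n then v.Z (k + 1) else tau S D w k v t

/-- For every `x` in the safe set, the proxy control `ν` minimizes `‖ν - ν_d‖²` over `K_BF`. -/
def SolvesQP (S : Plant p) (D : Design) (ν ν_d : State n p × ℝ → Vec (p 1)) : Prop :=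
  ∀ (v : State n p) (t : ℝ), v.x ∈ S.safeSet → 0 ≤ t →
    ν (v, t) ∈ KBF S D v.x v.mu t ∧
      ∀ w ∈ KBF S D v.x v.mu t, ‖ν (v, t) - ν_d (v, t)‖ ^ 2 ≤ ‖w - ν_d (v, t)‖ ^ 2

/-- The time interval `[0, T)`, where `T = ∞` is allowed. -/
def timeInterval (T : EReal) : Set ℝ := {t | 0 ≤ t ∧ (t : EReal) < T}

/-- Every disturbance `d_k`, `1 ≤ k ≤ n`, is differentiable with bounded derivative on `I`. -/
def BoundedRate (n : ℕ) (d : (k : ℕ) → ℝ → Vec (p k)) (I : Set ℝ) : Prop :=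
  ∀ k, 1 ≤ k → k ≤ n → DifferentiableOn ℝ (d k) I ∧ ∃ B : ℝ, ∀ t ∈ I, ‖derivWithin (d k) I t‖ ≤ B

/-- `v` solves on `I` the closed loop made of the disturbed strict-feedback system, the integrator
chain, the disturbance observer and the filters, under the proxy control `ν` and `u = τ_n`, with
`μ_1(0) = z_1(0)` and `μ_i(0) = 0` for `i ≥ 2`. -/
structure IsClosedLoop (S : Plant p) (D : Design) (ν : State n p × ℝ → Vec (p 1))
    (d : (k : ℕ) → ℝ → Vec (p k)) (I : Set ℝ) (v : ℝ → State n p) : Prop where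
  x_eq : ∀ t ∈ I,
    HasDerivWithinAt (fun r => (v r).x) (S.f₀ (v t).x + S.g₀ (v t).x ((v t).Z 1)) I t
  z_eq : ∀ t ∈ I, ∀ i : Fin n,
    HasDerivWithinAt (fun r => (v r).z i)
      (S.f (i + 1) ((v t).upTo (i + 1))
        + S.g (i + 1) ((v t).upTo (i + 1)) (stageInput S D (ν (v t, t)) (v t) t (i + 1))
        + d (i + 1) t) I t
  mu_eq : ∀ t ∈ I, ∀ i : Fin n,
    HasDerivWithinAt (fun r => (v r).mu i) ((v t).chain (ν (v t, t)) (i + 1)) I t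
  s_eq : ∀ t ∈ I, ∀ i : Fin n,
    HasDerivWithinAt (fun r => (v r).s i)
      (-(D.α (i + 1) • (S.f (i + 1) ((v t).upTo (i + 1))
        + S.g (i + 1) ((v t).upTo (i + 1)) (stageInput S D (ν (v t, t)) (v t) t (i + 1))
        + (v t).dHat D (i + 1) 0))) I t
  filt_eq : ∀ t ∈ I, ∀ (i : Fin n) (j : Fin (n - 1 - i)),
    HasDerivWithinAt (fun r => (v r).filt i j)
      (-(D.T (i + 1) (j + 1) • ((v t).dHat D (i + 1) (j + 1) - (v t).dHat D (i + 1) j))) I t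
  mu_init : ∀ i : Fin n, (v 0).mu i = if (i : ℕ) = 0 then (v 0).Z 1 else 0

end Controller

end PCBF

end

/-!
The proof is a continuation argument. Let `t₁` be the first time at which `‖e‖ < ρ` or `h(x) > 0`
fails. On `[0, t₁)` both hold, so the controller and the proxy control have their design
properties there, and each of the two inequalities is shown to persist at `t₁`.

*Safety* (`safe_at_end`). Write `b_i` for the functions of the proxy design. By the chain rule
(`bFun_hasDerivWithinAt`) and Young's inequality, a velocity `f₀ + g₀ (μ_1 + e)` with `‖e‖ ≤ ρ`
gives `b_i' + λ_{i+1} b_i ≥ b_{i+1}` for `i < n` (`bFun_succ_le`), while membership of the proxy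
control in `K_BF` gives `b_n' + λ_{n+1} b_n ≥ 0` (`bFun_last_le`). Scalar comparison from the top
level down keeps all `b_i` positive (`bFun_pos`), and `b_0 = χ(h(x)/ξ) > 0` forces `h(x) > 0`.

*Tracking* (`err_lt_at_end`). At points where `ρ² ≠ ‖e‖²` and all `g_k g_kᵀ` are invertible, the
virtual controls `τ_k` are smooth, and for `k < n` they do not depend on the observer states.
Hence the derivative of `τ_k` along the closed loop is the compensated term `𝒩_{k+1}` plus
`∑ ∂τ_k/∂z_j d_j` (`tau_hasDerivWithinAt`). In the Lyapunov function
`½ log (ρ² / (ρ² - ‖e‖²)) + ½ ∑ ‖ε_i‖²` the couplings of successive levels telescope, and the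
damping terms absorb the disturbance estimation errors up to a constant (`lyap_zero_le`,
`lyap_succ_le`). The estimation errors are continuous and hence bounded on `[0, t₁]`, so no decay
of the observer or of the filters is needed. The Lyapunov function is therefore bounded on
`[0, t₁)`, which keeps `ρ² - ‖e‖²` away from `0` up to `t₁`.

Both parts use that partial derivatives are total derivatives composed with an inclusion of
variables (`fderiv_translate`).
-/

namespace PCBF

/-! ### Partial derivatives and smoothness of the barrier functions -/

section Partial

variable {E W G : Type*} [NormedAddCommGroup E] [NormedSpace ℝ E] [NormedAddCommGroup W]
  [NormedSpace ℝ W] [NormedAddCommGroup G] [NormedSpace ℝ G]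

/-- The partial derivative of `F` along an inclusion `L` is the total derivative composed with
`L`. -/
theorem fderiv_translate {F : E → G} {q : E} (hF : DifferentiableAt ℝ F q) (L : W →L[ℝ] E)
    (w₀ : W) : fderiv ℝ (fun w => F (q + L (w - w₀))) w₀ = fderiv ℝ F q ∘L L := by
  have h1 : HasFDerivAt (fun w => q + L (w - w₀)) L w₀ :=
    (L.hasFDerivAt.comp w₀ ((hasFDerivAt_id w₀).sub_const w₀)).const_add q
  have h2 : HasFDerivAt F (fderiv ℝ F q) ((fun w => q + L (w - w₀)) w₀) := by
    simpa using hF.hasFDerivAt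
  exact (h2.comp w₀ h1).fderiv

theorem contDiffAt_fderiv_translate {m : ℕ} {F : E → G} {q₀ : E}
    (hF : ContDiffAt ℝ (m + 1 : ℕ) F q₀) (L : W →L[ℝ] E) (π : E → W) :
    ContDiffAt ℝ m (fun q => fderiv ℝ (fun w => F (q + L (w - π q))) (π q)) q₀ := by
  have h1 : ContDiffAt ℝ m (fun q => fderiv ℝ F q ∘L L) q₀ :=
    (hF.fderiv_right (m := m) (by norm_cast)).clm_comp contDiffAt_const
  refine h1.congr_of_eventuallyEq ?_
  filter_upwards [hF.eventually (by simp)] with q hq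
  exact fderiv_translate (hq.differentiableAt (by simp)) L (π q)

end Partial

/-- The operator norm of a linear functional on `ℝ^a` is the 2-norm of its row of entries. -/
theorem norm_sq_functional {a : ℕ} (L : Vec a →L[ℝ] ℝ) :
    ‖L‖ ^ 2 = ∑ i : Fin a, L (EuclideanSpace.single i 1) ^ 2 := by
  obtain ⟨y, rfl⟩ := (InnerProductSpace.toDual ℝ (Vec a)).surjective L
  rw [LinearIsometryEquiv.norm_map, EuclideanSpace.norm_sq_eq]
  refine Finset.sum_congr rfl fun i _ => ?_
  simp [EuclideanSpace.inner_single_right]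

theorem nth_of_lt {m : ℕ} {X : Type*} [Zero X] (a : Fin m → X) {i : ℕ} (h : i < m) :
    nth a i = a ⟨i, h⟩ := by simp [nth, h]

section ProxyCalculus

variable {n : ℕ} {p : ℕ → ℕ}

/-- The space of the variables `(x, μ, y, t)` of a proxy function. -/
abbrev ProxyVar (n : ℕ) (p : ℕ → ℕ) : Type :=
  Vec (p 0) × (Fin n → Vec (p 1)) × (Fin (n + 2) → ℝ) × ℝ

/-- A proxy function as a function of the tuple of its variables. -/
def ProxyFun.joint (b : ProxyFun n p) (q : ProxyVar n p) : ℝ := b q.1 q.2.1 q.2.2.1 q.2.2.2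

/-- Inclusion of the variable `x`. -/
def proxyInX : Vec (p 0) →L[ℝ] ProxyVar n p := ContinuousLinearMap.inl ℝ _ _

/-- Inclusion of the variable `μ_{j+1}`. -/
def proxyInMu (j : Fin n) : Vec (p 1) →L[ℝ] ProxyVar n p :=
  ContinuousLinearMap.inr ℝ _ _ ∘L ContinuousLinearMap.inl ℝ _ _ ∘L
    ContinuousLinearMap.single ℝ (fun _ : Fin n => Vec (p 1)) j

/-- Inclusion of the variable `y_j`. -/
def proxyInY (j : Fin (n + 2)) : ℝ →L[ℝ] ProxyVar n p :=
  ContinuousLinearMap.inr ℝ _ _ ∘L ContinuousLinearMap.inr ℝ _ _ ∘L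
    ContinuousLinearMap.inl ℝ _ _ ∘L ContinuousLinearMap.single ℝ (fun _ : Fin (n + 2) => ℝ) j

/-- Inclusion of the variable `t`. -/
def proxyInT : ℝ →L[ℝ] ProxyVar n p :=
  ContinuousLinearMap.inr ℝ _ _ ∘L ContinuousLinearMap.inr ℝ _ _ ∘L
    ContinuousLinearMap.inr ℝ _ _

theorem update_eq_add_single {ι : Type*} [DecidableEq ι] {X : ι → Type*}
    [∀ i, AddCommGroup (X i)] (a : (i : ι) → X i) (j : ι) (w : X j) :
    Function.update a j w = a + Pi.single j (w - a j) := by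
  ext i
  by_cases h : i = j
  · subst h; simp
  · simp [h]

theorem proxy_x_eq (b : ProxyFun n p) (q : ProxyVar n p) :
    (fun x' => b x' q.2.1 q.2.2.1 q.2.2.2) = fun w => b.joint (q + proxyInX (w - q.1)) := by
  ext w; simp [ProxyFun.joint, proxyInX]

theorem proxy_mu_eq (b : ProxyFun n p) (q : ProxyVar n p) (j : Fin n) :
    (fun w => b q.1 (Function.update q.2.1 j w) q.2.2.1 q.2.2.2)
      = fun w => b.joint (q + proxyInMu j (w - q.2.1 j)) := by
  ext w; simp [ProxyFun.joint, proxyInMu, update_eq_add_single]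

theorem proxy_y_eq (b : ProxyFun n p) (q : ProxyVar n p) (j : Fin (n + 2)) :
    (fun w => b q.1 q.2.1 (Function.update q.2.2.1 j w) q.2.2.2)
      = fun w => b.joint (q + proxyInY j (w - q.2.2.1 j)) := by
  ext w; simp [ProxyFun.joint, proxyInY, update_eq_add_single]

theorem proxy_t_eq (b : ProxyFun n p) (q : ProxyVar n p) :
    (fun w => b q.1 q.2.1 q.2.2.1 w) = fun w => b.joint (q + proxyInT (w - q.2.2.2)) := by
  ext w; simp [ProxyFun.joint, proxyInT]

theorem contDiff_proxy_x {m : ℕ} {b : ProxyFun n p} (hb : ContDiff ℝ (m + 1 : ℕ) b.joint) :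
    ContDiff ℝ m fun q : ProxyVar n p =>
      fderiv ℝ (fun x' => b x' q.2.1 q.2.2.1 q.2.2.2) q.1 := by
  simp_rw [proxy_x_eq b]
  exact contDiff_iff_contDiffAt.2 fun q =>
    contDiffAt_fderiv_translate hb.contDiffAt proxyInX fun q => q.1

theorem contDiff_proxy_mu {m : ℕ} {b : ProxyFun n p} (hb : ContDiff ℝ (m + 1 : ℕ) b.joint)
    (j : Fin n) :
    ContDiff ℝ m fun q : ProxyVar n p => dMuProxy b q.1 q.2.1 q.2.2.1 q.2.2.2 j := by
  simp_rw [dMuProxy, proxy_mu_eq b]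
  exact contDiff_iff_contDiffAt.2 fun q =>
    contDiffAt_fderiv_translate hb.contDiffAt (proxyInMu j) fun q => q.2.1 j

theorem contDiff_proxy_y {m : ℕ} {b : ProxyFun n p} (hb : ContDiff ℝ (m + 1 : ℕ) b.joint)
    (j : Fin (n + 2)) :
    ContDiff ℝ m fun q : ProxyVar n p =>
      deriv (fun r => b q.1 q.2.1 (Function.update q.2.2.1 j r) q.2.2.2) (q.2.2.1 j) := by
  simp_rw [← fderiv_apply_one_eq_deriv, proxy_y_eq b]
  exact (contDiff_iff_contDiffAt.2 fun q =>
    contDiffAt_fderiv_translate hb.contDiffAt (proxyInY j) fun q => q.2.2.1 j).clm_apply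
      contDiff_const

theorem contDiff_proxy_t {m : ℕ} {b : ProxyFun n p} (hb : ContDiff ℝ (m + 1 : ℕ) b.joint) :
    ContDiff ℝ m fun q : ProxyVar n p => deriv (fun t => b q.1 q.2.1 q.2.2.1 t) q.2.2.2 := by
  simp_rw [← fderiv_apply_one_eq_deriv, proxy_t_eq b]
  exact (contDiff_iff_contDiffAt.2 fun q =>
    contDiffAt_fderiv_translate hb.contDiffAt proxyInT fun q => q.2.2.2).clm_apply
      contDiff_const

theorem contDiff_nth {X : Type*} [NormedAddCommGroup X] [NormedSpace ℝ X] {k : ℕ} (i : ℕ)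
    {m : WithTop ℕ∞} : ContDiff ℝ m fun a : Fin k → X => nth a i := by
  by_cases h : i < k
  · simp only [nth, h, dite_true]; exact contDiff_apply ℝ X _
  · simp only [nth, h, dite_false]; exact contDiff_const

/-- `b_i` loses one order of differentiability at each step. -/
theorem contDiff_bFun {S : Plant p} {D : Design} (hS : S.IsSmooth n) (hρ : ContDiff ℝ ∞ D.ρ)
    (i m : ℕ) (him : i + m ≤ n + 1) : ContDiff ℝ m (bFun S D i : ProxyFun n p).joint := by
  induction i generalizing m with
  | zero =>
    show ContDiff ℝ m fun q : ProxyVar n p => q.2.2.1 0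
    fun_prop
  | succ i ih =>
    have hb := ih (m + 1) (by omega)
    have hb0 := ih m (by omega)
    obtain ⟨hf, hg, hh, -⟩ := hS
    have hmn : ((m + 1 : ℕ) : WithTop ℕ∞) ≤ (n + 1 : WithTop ℕ∞) := by
      have : m + 1 ≤ n + 1 := by omega
      exact_mod_cast this
    have hmn' : (m : WithTop ℕ∞) ≤ (n + 1 : WithTop ℕ∞) := by
      have : m ≤ n + 1 := by omega
      exact_mod_cast this
    have hf' := hf.of_le hmn'
    have hg' := hg.of_le hmn'
    have hh' : ContDiff ℝ m (fderiv ℝ S.h) := (hh.of_le hmn).fderiv_right (by norm_cast)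
    have hρ' : ContDiff ℝ m D.ρ := hρ.of_le (by exact_mod_cast le_top)
    have hM : ContDiff ℝ m fun q : ProxyVar n p =>
        mRow S D i (bFun S D i) q.1 q.2.1 q.2.2.1 q.2.2.2 := by
      unfold mRow
      refine ContDiff.add (ContDiff.const_smul _ (ContDiff.sum fun j _ => ?_))
        (contDiff_proxy_x hb)
      exact ((contDiff_proxy_y hb j).mul ((contDiff_nth _).comp (by fun_prop))).smul
        (hh'.comp (by fun_prop))
    have hMg : ContDiff ℝ m fun q : ProxyVar n p =>
        ‖mRow S D i (bFun S D i) q.1 q.2.1 q.2.2.1 q.2.2.2 ∘L S.g₀ q.1‖ ^ 2 := by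
      simp_rw [norm_sq_functional]
      exact ContDiff.sum fun j _ =>
        ((hM.clm_comp (hg'.comp contDiff_fst)).clm_apply contDiff_const).pow 2
    show ContDiff ℝ m fun q : ProxyVar n p =>
      (bFun S D (i + 1) : ProxyFun n p) q.1 q.2.1 q.2.2.1 q.2.2.2
    unfold bFun
    refine ContDiff.add (ContDiff.add (ContDiff.add (ContDiff.sub (ContDiff.sub ?_ ?_) ?_) ?_)
      (contDiff_proxy_t hb)) (ContDiff.sum fun j _ => ?_)
    · exact hM.clm_apply ((hf'.comp contDiff_fst).add
        ((hg'.comp contDiff_fst).clm_apply ((contDiff_nth 0).comp (by fun_prop))))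
    · exact hMg.div_const _
    · exact contDiff_const.mul ((hρ'.comp (by fun_prop)).pow 2)
    · exact contDiff_const.mul hb0
    · exact (contDiff_proxy_mu hb j).clm_apply ((contDiff_nth _).comp (by fun_prop))

/-- `b_i` depends on `μ_1, …, μ_i` and `y_0, …, y_i` only. -/
theorem bFun_congr (S : Plant p) (D : Design) (i : ℕ) (x : Vec (p 0)) {μ μ' : Fin n → Vec (p 1)}
    {y y' : Fin (n + 2) → ℝ} (t : ℝ) (hμ : ∀ j : Fin n, j.val < i → μ j = μ' j)
    (hy : ∀ j : Fin (n + 2), j.val ≤ i → y j = y' j) :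
    bFun S D i x μ y t = bFun S D i x μ' y' t := by
  induction i generalizing x μ μ' y y' t with
  | zero => exact hy 0 le_rfl
  | succ i ih =>
    have hμ1 : ∀ j : Fin n, j.val < i → μ j = μ' j := fun j hj => hμ j (by omega)
    have hy1 : ∀ j : Fin (n + 2), j.val ≤ i → y j = y' j := fun j hj => hy j (by omega)
    have nμ : ∀ j, j < i + 1 → nth μ j = nth μ' j := by
      intro j hj
      by_cases h : j < n
      · simp only [nth_of_lt _ h]; exact hμ _ hj
      · simp [nth, h]
    have ny : ∀ j, j ≤ i + 1 → nth y j = nth y' j := by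
      intro j hj
      by_cases h : j < n + 2
      · simp only [nth_of_lt _ h]; exact hy _ hj
      · simp [nth, h]
    have hM : mRow S D i (bFun S D i) x μ y t = mRow S D i (bFun S D i) x μ' y' t := by
      unfold mRow
      congr 1
      · congr 1
        refine Finset.sum_congr rfl fun j hj => ?_
        have hj' : j.val ≤ i := by simpa using hj
        rw [ny _ (by omega), hy1 j hj']
        congr 3
        ext r
        refine ih x t hμ1 fun l hl => ?_
        by_cases h : l = j
        · subst h; simp
        · simp [h, hy1 l hl]
      · congr 1
        ext x'
        exact ih x' t hμ1 hy1
    have hT : deriv (fun t' => bFun S D i x μ y t') t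
        = deriv (fun t' => bFun S D i x μ' y' t') t := by
      congr 1
      ext t'
      exact ih x t' hμ1 hy1
    have hMu : ∀ j : Fin n, j.val < i →
        dMuProxy (bFun S D i) x μ y t j = dMuProxy (bFun S D i) x μ' y' t j := by
      intro j hj
      unfold dMuProxy
      rw [hμ1 j hj]
      congr 1
      ext w
      refine ih x t (fun l hl => ?_) hy1
      by_cases h : l = j
      · subst h; simp
      · simp [h, hμ1 l hl]
    unfold bFun
    rw [hM, hT, nμ 0 (by omega), ih x t hμ1 hy1]
    congr 1
    refine Finset.sum_congr rfl fun j hj => ?_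
    have hj' : j.val < i := by simpa using hj
    rw [hMu j hj', nμ _ (by omega)]

end ProxyCalculus

/-! ### Barrier functions along trajectories -/

section ProxyTrajectory

variable {n : ℕ} {p : ℕ → ℕ}

theorem ProxyFun.hasDerivWithinAt {b : ProxyFun n p} {I : Set ℝ} {t : ℝ} {x : ℝ → Vec (p 0)}
    {μ : ℝ → Fin n → Vec (p 1)} {y : ℝ → Fin (n + 2) → ℝ} {x' : Vec (p 0)} {μ' : Fin n → Vec (p 1)}
    {y' : Fin (n + 2) → ℝ} (hb : DifferentiableAt ℝ b.joint (x t, μ t, y t, t))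
    (hx : HasDerivWithinAt x x' I t) (hμ : ∀ j, HasDerivWithinAt (fun r => μ r j) (μ' j) I t)
    (hy : ∀ j, HasDerivWithinAt (fun r => y r j) (y' j) I t) :
    HasDerivWithinAt (fun r => b (x r) (μ r) (y r) r)
      (fderiv ℝ (fun w => b w (μ t) (y t) t) (x t) x'
        + ∑ j, dMuProxy b (x t) (μ t) (y t) t j (μ' j)
        + ∑ j, deriv (fun r => b (x t) (μ t) (Function.update (y t) j r) t) (y t j) * y' j
        + deriv (fun r => b (x t) (μ t) (y t) r) t) I t := by
  set q : ProxyVar n p := (x t, μ t, y t, t) with hq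
  have hγ : HasDerivWithinAt (fun r => ((x r, μ r, y r, r) : ProxyVar n p)) (x', μ', y', 1) I t :=
    hx.prodMk ((hasDerivWithinAt_pi.2 hμ).prodMk
      ((hasDerivWithinAt_pi.2 hy).prodMk (hasDerivWithinAt_id t I)))
  have hmain := HasFDerivAt.comp_hasDerivWithinAt t
    (f := fun r => ((x r, μ r, y r, r) : ProxyVar n p))
    hb.hasFDerivAt hγ
  have hdec : ((x', μ', y', 1) : ProxyVar n p) = proxyInX x' + ∑ j, proxyInMu j (μ' j)
      + ∑ j, proxyInY j (y' j) + proxyInT 1 := by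
    simp only [proxyInX, proxyInMu, proxyInY, proxyInT, ContinuousLinearMap.comp_apply,
      ← map_sum, ContinuousLinearMap.single_apply, Finset.univ_sum_single]
    simp
  have e1 := fderiv_translate hb (proxyInX (n := n) (p := p)) q.1
  have e2 := fun j => fderiv_translate hb (proxyInMu (n := n) (p := p) j) (q.2.1 j)
  have e3 := fun j => fderiv_translate hb (proxyInY (n := n) (p := p) j) (q.2.2.1 j)
  have e4 := fderiv_translate hb (proxyInT (n := n) (p := p)) q.2.2.2
  rw [← proxy_x_eq b q] at e1
  simp_rw [← proxy_mu_eq b q] at e2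
  simp_rw [← proxy_y_eq b q] at e3
  rw [← proxy_t_eq b q] at e4
  refine hmain.congr_deriv ?_
  rw [hdec, map_add, map_add, map_add, map_sum, map_sum]
  congr 1
  congr 1
  congr 1
  · exact (DFunLike.congr_fun e1 x').symm
  · exact Finset.sum_congr rfl fun j _ => (DFunLike.congr_fun (e2 j) (μ' j)).symm
  · refine Finset.sum_congr rfl fun j _ => ?_
    have := DFunLike.congr_fun (e3 j) (y' j)
    rw [mul_comm, ← smul_eq_mul, ← fderiv_apply_one_eq_deriv, ← map_smul, smul_eq_mul, mul_one]
    exact this.symm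
  · rw [← fderiv_apply_one_eq_deriv]; exact (DFunLike.congr_fun e4 1).symm

/-- Total derivative of `b_i` along a trajectory: the derivatives of the `y_j = χ^{(j)}(h / ξ)`
combine with `∂b_i/∂x` to the row `M_{i+1}`. -/
theorem bFun_hasDerivWithinAt {S : Plant p} {D : Design} (hS : S.IsSmooth n)
    (hρ : ContDiff ℝ ∞ D.ρ) (hχ : D.Saturation n) {i : ℕ} (hi : i ≤ n) {I : Set ℝ} {t : ℝ}
    {x : ℝ → Vec (p 0)} {μ : ℝ → Fin n → Vec (p 1)} {x' : Vec (p 0)} {μ' : Fin n → Vec (p 1)}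
    (hx : HasDerivWithinAt x x' I t) (hμ : ∀ j, HasDerivWithinAt (fun r => μ r j) (μ' j) I t) :
    HasDerivWithinAt (fun r => bFun S D i (x r) (μ r) (yVal n S D (x r)) r)
      (mRow S D i (bFun S D i) (x t) (μ t) (yVal n S D (x t)) t x'
        + deriv (fun r => bFun S D i (x t) (μ t) (yVal n S D (x t)) r) t
        + ∑ j : Fin n with j.val < i,
            dMuProxy (bFun S D i) (x t) (μ t) (yVal n S D (x t)) t j (μ' j)) I t := by
  -- `y_{n+1}` need not be differentiable; as `b_i` does not depend on it, it is frozen at time `t`.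
  set Y : ℝ → Fin (n + 2) → ℝ := fun r j =>
    if j.val ≤ n then yVal n S D (x r) j else yVal n S D (x t) j with hY
  have hYt : Y t = yVal n S D (x t) := by ext j; simp [hY]
  have hcongr : ∀ r, bFun S D i (x r) (μ r) (yVal n S D (x r)) r
      = bFun S D i (x r) (μ r) (Y r) r := fun r =>
    bFun_congr S D i (x r) r (fun _ _ => rfl) fun j hj => by simp [hY, hj.trans hi]
  have hh : DifferentiableAt ℝ S.h (x t) := (hS.2.2.1.differentiable (by simp)).differentiableAt
  have hhx : HasDerivWithinAt (fun r => S.h (x r) / D.ξ) (fderiv ℝ S.h (x t) x' / D.ξ) I t :=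
    (hh.hasFDerivAt.comp_hasDerivWithinAt t hx).div_const _
  set Y' : Fin (n + 2) → ℝ := fun j =>
    if j.val ≤ n then nth (yVal n S D (x t)) (j + 1) * (fderiv ℝ S.h (x t) x' / D.ξ) else 0 with hY'
  have hyd : ∀ j, HasDerivWithinAt (fun r => Y r j) (Y' j) I t := by
    intro j
    by_cases hj : j.val ≤ n
    · simp only [hY, hY', hj, if_true]
      have h1 := ((hχ.1 j hj) (S.h (x t) / D.ξ)).hasDerivAt
      rw [← iteratedDeriv_succ] at h1
      have h2 := HasDerivAt.comp_hasDerivWithinAt t (h := fun r => S.h (x r) / D.ξ) h1 hhx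
      rw [nth_of_lt _ (show j.val + 1 < n + 2 by omega)]
      exact h2
    · simp only [hY, hY', hj, if_false]
      exact hasDerivWithinAt_const _ _ _
  have hb : DifferentiableAt ℝ (bFun S D i : ProxyFun n p).joint (x t, μ t, Y t, t) :=
    ((contDiff_bFun hS hρ i 1 (by omega)).differentiable (by simp)).differentiableAt
  have hmain := (ProxyFun.hasDerivWithinAt hb hx hμ hyd).congr (fun r _ => hcongr r) (hcongr t)
  refine hmain.congr_deriv ?_
  rw [hYt]
  have hmu : ∑ j, dMuProxy (bFun S D i) (x t) (μ t) (yVal n S D (x t)) t j (μ' j)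
      = ∑ j : Fin n with j.val < i,
            dMuProxy (bFun S D i) (x t) (μ t) (yVal n S D (x t)) t j (μ' j) := by
    symm
    refine Finset.sum_subset (Finset.filter_subset _ _) fun j _ hj => ?_
    have hj' : ¬ j.val < i := by simpa using hj
    have : (fun w => (bFun S D i : ProxyFun n p) (x t) (Function.update (μ t) j w)
        (yVal n S D (x t)) t) = fun _ => bFun S D i (x t) (μ t) (yVal n S D (x t)) t := by
      ext w
      refine bFun_congr S D i _ _ (fun l hl => ?_) fun _ _ => rfl
      rw [Function.update_of_ne]; rintro rfl; exact hj' hl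
    simp [dMuProxy, this]
  have hy : ∑ j, deriv (fun r => (bFun S D i : ProxyFun n p) (x t) (μ t)
        (Function.update (yVal n S D (x t)) j r) t) (yVal n S D (x t) j) * Y' j
      = (1 / D.ξ) * (∑ j : Fin (n + 2) with j.val ≤ i,
        deriv (fun r => (bFun S D i : ProxyFun n p) (x t) (μ t)
          (Function.update (yVal n S D (x t)) j r) t) (yVal n S D (x t) j)
          * nth (yVal n S D (x t)) (j + 1) * fderiv ℝ S.h (x t) x') := by
    rw [Finset.mul_sum]
    symm
    refine Finset.sum_subset_zero_on_sdiff (Finset.filter_subset _ _) (fun j hj => ?_)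
      fun j hj => ?_
    · have hj' : ¬ j.val ≤ i := by simpa using hj
      have : (fun r => (bFun S D i : ProxyFun n p) (x t) (μ t)
          (Function.update (yVal n S D (x t)) j r) t)
          = fun _ => bFun S D i (x t) (μ t) (yVal n S D (x t)) t := by
        ext w
        refine bFun_congr S D i _ _ (fun _ _ => rfl) fun l hl => ?_
        rw [Function.update_of_ne]; rintro rfl; exact hj' hl
      simp [this]
    · have hj' : j.val ≤ i := by simpa using hj
      simp only [hY', hj'.trans hi, if_true]
      ring
  rw [hmu, hy]
  simp only [mRow, add_apply, smul_apply, sum_apply, smul_eq_mul]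
  ring

/-- Below the last level, `b_i' + λ_{i+1} b_i ≥ b_{i+1}` for the disturbed velocity
`f₀ + g₀ (μ_1 + e)` as long as `‖e‖ ≤ ρ` (Young's inequality). -/
theorem bFun_succ_le {S : Plant p} {D : Design} {i : ℕ} (hβ : 0 < D.β (i + 1))
    {x : Vec (p 0)} {μ μ' : Fin n → Vec (p 1)} {y : Fin (n + 2) → ℝ} {t : ℝ} {e : Vec (p 1)}
    (he : ‖e‖ ≤ D.ρ t) (hμ' : ∀ j : Fin n, j.val < i → μ' j = nth μ (j + 1)) :
    bFun S D (i + 1) x μ y t - D.lam (i + 1) * bFun S D i x μ y t ≤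
      mRow S D i (bFun S D i) x μ y t (S.f₀ x + S.g₀ x (nth μ 0 + e))
        + deriv (fun r => bFun S D i x μ y r) t
        + ∑ j : Fin n with j.val < i, dMuProxy (bFun S D i) x μ y t j (μ' j) := by
  have hsum : ∑ j : Fin n with j.val < i, dMuProxy (bFun S D i) x μ y t j (μ' j)
      = ∑ j : Fin n with j.val < i, dMuProxy (bFun S D i) x μ y t j (nth μ (j + 1)) :=
    Finset.sum_congr rfl fun j hj => by rw [hμ' j (by simpa using hj)]
  rw [hsum, map_add (S.g₀ x), ← add_assoc (S.f₀ x),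
    map_add (mRow S D i (bFun S D i) x μ y t) (S.f₀ x + _)]
  simp only [bFun]
  have h1 := (mRow S D i (bFun S D i) x μ y t ∘L S.g₀ x).le_opNorm e
  rw [Real.norm_eq_abs] at h1
  have h2 := (abs_le.1 h1).1
  set c := ‖mRow S D i (bFun S D i) x μ y t ∘L S.g₀ x‖
  have hc : 0 ≤ c := norm_nonneg _
  have h3 : c * ‖e‖ ≤ c * D.ρ t := mul_le_mul_of_nonneg_left he hc
  have h4 : c * D.ρ t ≤ c ^ 2 / (2 * D.β (i + 1)) + D.β (i + 1) / 2 * D.ρ t ^ 2 := by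
    have : c ^ 2 / (2 * D.β (i + 1)) + D.β (i + 1) / 2 * D.ρ t ^ 2 - c * D.ρ t
        = (c - D.β (i + 1) * D.ρ t) ^ 2 / (2 * D.β (i + 1)) := by
      field_simp; ring
    have h5 : 0 ≤ (c - D.β (i + 1) * D.ρ t) ^ 2 / (2 * D.β (i + 1)) := by positivity
    linarith
  rw [ContinuousLinearMap.comp_apply] at h2
  linarith

/-- At the last level, the constraint `ψ₀ + ψ₁ w ≥ 0` on the proxy control gives
`b_n' + λ_{n+1} b_n ≥ 0`. -/
theorem bFun_last_le {S : Plant p} {D : Design} (hn : 0 < n)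
    {x : Vec (p 0)} {μ μ' : Fin n → Vec (p 1)} {t : ℝ} {e w : Vec (p 1)}
    (he : ‖e‖ ≤ D.ρ t) (hw : w ∈ KBF S D x μ t)
    (hμ' : ∀ j : Fin n, μ' j = if j.val + 1 < n then nth μ (j + 1) else w) :
    - (D.lam (n + 1) * bFun S D n x μ (yVal n S D x) t) ≤
      mRow S D n (bFun S D n) x μ (yVal n S D x) t (S.f₀ x + S.g₀ x (nth μ 0 + e))
        + deriv (fun r => bFun S D n x μ (yVal n S D x) r) t
        + ∑ j : Fin n with j.val < n, dMuProxy (bFun S D n) x μ (yVal n S D x) t j (μ' j) := by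
  set y := yVal n S D x with hy
  have hsum : ∑ j : Fin n with j.val < n, dMuProxy (bFun S D n) x μ y t j (μ' j)
      = ∑ j : Fin n with j.val + 1 < n, dMuProxy (bFun S D n) x μ y t j (nth μ (j + 1))
        + psi1 S D x μ t w := by
    rw [Finset.filter_true_of_mem (fun j _ => j.isLt),
      ← Finset.sum_filter_add_sum_filter_not Finset.univ (fun j : Fin n => j.val + 1 < n)]
    congr 1
    · exact Finset.sum_congr rfl fun j hj => by
        have : j.val + 1 < n := by simpa using hj
        rw [hμ' j, if_pos this]
    · rw [Finset.sum_eq_single_of_mem (⟨n - 1, by omega⟩ : Fin n)]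
      · have h : ¬ (n - 1 + 1 < n) := by omega
        rw [hμ', if_neg h, psi1, dif_pos hn]
      · simp; omega
      · intro j hj hne
        exact absurd (Fin.ext (by simp at hj; simp; omega)) hne
  have hK : 0 ≤ psi0 S D x μ t + psi1 S D x μ t w := hw
  rw [psi0, ← hy] at hK
  rw [hsum, map_add (S.g₀ x), ← add_assoc (S.f₀ x),
    map_add (mRow S D n (bFun S D n) x μ y t) (S.f₀ x + _)]
  have h1 := (mRow S D n (bFun S D n) x μ y t ∘L S.g₀ x).le_opNorm e
  rw [Real.norm_eq_abs] at h1
  have h2 := (abs_le.1 h1).1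
  rw [ContinuousLinearMap.comp_apply] at h2
  have h3 := mul_le_mul_of_nonneg_left he
    (norm_nonneg (mRow S D n (bFun S D n) x μ y t ∘L S.g₀ x))
  linarith

/-- Scalar comparison: `b' ≥ -λ b` in the interior keeps a positive initial value positive. -/
theorem pos_of_deriv_ge {b b' : ℝ → ℝ} {lam t₀ t₁ : ℝ} (h01 : t₀ ≤ t₁)
    (hb : ∀ t ∈ Set.Icc t₀ t₁, HasDerivWithinAt b (b' t) (Set.Icc t₀ t₁) t)
    (hb' : ∀ t ∈ Set.Ioo t₀ t₁, -(lam * b t) ≤ b' t) (h0 : 0 < b t₀) :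
    ∀ t ∈ Set.Icc t₀ t₁, 0 < b t := by
  have hd : ∀ t ∈ Set.Icc t₀ t₁, HasDerivWithinAt (fun t => Real.exp (lam * t) * b t)
      (Real.exp (lam * t) * lam * b t + Real.exp (lam * t) * b' t) (Set.Icc t₀ t₁) t := by
    intro t ht
    have h1 : HasDerivAt (fun t => Real.exp (lam * t)) (Real.exp (lam * t) * lam) t := by
      simpa using ((hasDerivAt_id t).const_mul lam).exp
    exact h1.hasDerivWithinAt.mul (hb t ht)
  have hm : MonotoneOn (fun t => Real.exp (lam * t) * b t) (Set.Icc t₀ t₁) := by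
    refine monotoneOn_of_hasDerivWithinAt_nonneg (convex_Icc _ _)
      (fun t ht => (hd t ht).continuousWithinAt)
      (f' := fun t => Real.exp (lam * t) * lam * b t + Real.exp (lam * t) * b' t) ?_ ?_
    · intro t ht
      exact (hd t (interior_subset ht)).mono interior_subset
    · intro t ht
      rw [interior_Icc] at ht
      have := hb' t ht
      have h2 := Real.exp_pos (lam * t)
      have h3 : 0 ≤ Real.exp (lam * t) * (lam * b t + b' t) := mul_nonneg h2.le (by linarith)
      linarith
  intro t ht
  have h1 := hm (Set.left_mem_Icc.2 h01) ht ht.1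
  have h2 : 0 < Real.exp (lam * t₀) * b t₀ := mul_pos (Real.exp_pos _) h0
  exact pos_of_mul_pos_right (h2.trans_le h1) (Real.exp_pos _).le

/-- `χ` is not positive on `(-∞, 0]`, since it vanishes at `0` and increases up to `1`. -/
theorem Design.Saturation.pos_of_pos {D : Design} (hχ : D.Saturation n) {r : ℝ}
    (h : 0 < D.χ r) : 0 < r := by
  by_contra hr
  push Not at hr
  have hd : Differentiable ℝ D.χ := by simpa using hχ.1 0 (Nat.zero_le n)
  have hm : StrictMonoOn D.χ (Set.Iic 0) :=
    strictMonoOn_of_deriv_pos (convex_Iic 0) hd.continuous.continuousOn fun s hs => by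
      rw [interior_Iic] at hs
      exact hχ.2.2.2 s (lt_trans hs one_pos)
  have := hm.monotoneOn hr (Set.mem_Iic.2 le_rfl) hr
  rw [hχ.2.1] at this
  linarith

end ProxyTrajectory

/-- Along a trajectory of `x' = f₀ + g₀ (μ_1 + e)` with `‖e‖ ≤ ρ`, a proxy control in `K_BF` keeps
all `b_i` positive: positivity passes from `b_{i+1}` to `b_i` by scalar comparison. -/
theorem bFun_pos {n : ℕ} {p : ℕ → ℕ} {S : Plant p} {D : Design} (hn : 0 < n) (hS : S.IsSmooth n)
    (hρ : ContDiff ℝ ∞ D.ρ) (hχ : D.Saturation n) (hβ : ∀ i, 1 ≤ i → i ≤ n → 0 < D.β i) {t₁ : ℝ}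
    (ht₁ : 0 ≤ t₁) {x : ℝ → Vec (p 0)} {μ : ℝ → Fin n → Vec (p 1)} {e w : ℝ → Vec (p 1)}
    (hx : ∀ t ∈ Set.Icc 0 t₁, HasDerivWithinAt x
      (S.f₀ (x t) + S.g₀ (x t) (nth (μ t) 0 + e t)) (Set.Icc 0 t₁) t)
    (hμ : ∀ t ∈ Set.Icc 0 t₁, ∀ j : Fin n, HasDerivWithinAt (fun r => μ r j)
      (if j.val + 1 < n then nth (μ t) (j + 1) else w t) (Set.Icc 0 t₁) t)
    (he : ∀ t ∈ Set.Ioo 0 t₁, ‖e t‖ ≤ D.ρ t)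
    (hw : ∀ t ∈ Set.Ioo 0 t₁, w t ∈ KBF S D (x t) (μ t) t)
    (h0 : ∀ i ≤ n, 0 < bFun S D i (x 0) (μ 0) (yVal n S D (x 0)) 0) :
    ∀ i ≤ n, ∀ t ∈ Set.Icc 0 t₁, 0 < bFun S D i (x t) (μ t) (yVal n S D (x t)) t := by
  intro i hi
  refine Nat.decreasingInduction' (P := fun i => i ≤ n → ∀ t ∈ Set.Icc 0 t₁,
    0 < bFun S D i (x t) (μ t) (yVal n S D (x t)) t) (m := i) (n := n) ?_ hi ?_ hi
  · intro k hk _ ih hkn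
    refine pos_of_deriv_ge (lam := D.lam (k + 1)) ht₁
      (fun t ht => bFun_hasDerivWithinAt hS hρ hχ hkn (hx t ht) (hμ t ht)) (fun t ht => ?_)
      (h0 k hkn)
    have h1 := bFun_succ_le (S := S) (D := D) (x := x t) (y := yVal n S D (x t)) (i := k)
      (hβ (k + 1) (by omega) (by omega)) (he t ht)
      (μ := μ t) (μ' := fun j => if j.val + 1 < n then nth (μ t) (j + 1) else w t)
      fun j hj => by simp [show j.val + 1 < n by omega]
    have h2 := ih (by omega) t (Set.Ioo_subset_Icc_self ht)
    linarith
  · intro _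
    refine pos_of_deriv_ge (lam := D.lam (n + 1)) ht₁
      (fun t ht => bFun_hasDerivWithinAt hS hρ hχ le_rfl (hx t ht) (hμ t ht)) (fun t ht => ?_)
      (h0 n le_rfl)
    exact bFun_last_le hn (he t ht) (hw t ht) fun j => rfl

/-! ### Smoothness of the control laws -/

section ControllerCalculus

variable {n : ℕ} {p : ℕ → ℕ} {m : ℕ}

/-- Inclusion of the variable `x`. -/
def inX : Vec (p 0) →L[ℝ] State n p × ℝ :=
  ContinuousLinearMap.inl ℝ _ _ ∘L ContinuousLinearMap.inl ℝ _ _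

/-- Inclusion of the variable `z_{j+1}`. -/
def inZ (j : Fin n) : Vec (p (j + 1)) →L[ℝ] State n p × ℝ :=
  ContinuousLinearMap.inl ℝ _ _ ∘L ContinuousLinearMap.inr ℝ _ _ ∘L
    ContinuousLinearMap.inl ℝ _ _ ∘L
    ContinuousLinearMap.single ℝ (fun i : Fin n => Vec (p (i + 1))) j

/-- Inclusion of the variable `μ_{j+1}`. -/
def inMu (j : Fin n) : Vec (p 1) →L[ℝ] State n p × ℝ :=
  ContinuousLinearMap.inl ℝ _ _ ∘L ContinuousLinearMap.inr ℝ _ _ ∘L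
    ContinuousLinearMap.inr ℝ _ _ ∘L ContinuousLinearMap.inl ℝ _ _ ∘L
    ContinuousLinearMap.single ℝ (fun _ : Fin n => Vec (p 1)) j

/-- Inclusion of the observer state `s_{j+1}`. -/
def inS (j : Fin n) : Vec (p (j + 1)) →L[ℝ] State n p × ℝ :=
  ContinuousLinearMap.inl ℝ _ _ ∘L ContinuousLinearMap.inr ℝ _ _ ∘L
    ContinuousLinearMap.inr ℝ _ _ ∘L ContinuousLinearMap.inr ℝ _ _ ∘L
    ContinuousLinearMap.inl ℝ _ _ ∘L
    ContinuousLinearMap.single ℝ (fun i : Fin n => Vec (p (i + 1))) j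

/-- Inclusion of the filter state `d̂^f_{j+1,l+1}`. -/
def inFilt (j : Fin n) (l : Fin (n - 1 - j)) : Vec (p (j + 1)) →L[ℝ] State n p × ℝ :=
  ContinuousLinearMap.inl ℝ _ _ ∘L ContinuousLinearMap.inr ℝ _ _ ∘L
    ContinuousLinearMap.inr ℝ _ _ ∘L ContinuousLinearMap.inr ℝ _ _ ∘L
    ContinuousLinearMap.inr ℝ _ _ ∘L
    ContinuousLinearMap.single ℝ (fun i : Fin n => Fin (n - 1 - i) → Vec (p (i + 1))) j ∘L
    ContinuousLinearMap.single ℝ (fun _ : Fin (n - 1 - j) => Vec (p (j + 1))) l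

/-- Inclusion of the time variable. -/
def inTime : ℝ →L[ℝ] State n p × ℝ := ContinuousLinearMap.inr ℝ _ _

/-- A function of state and time as a function of the pair. -/
def joint (F : State n p → ℝ → Vec m) (q : State n p × ℝ) : Vec m := F q.1 q.2

theorem setX_eq (F : State n p → ℝ → Vec m) (q : State n p × ℝ) :
    (fun w => F (q.1.setX w) q.2) = fun w => joint F (q + inX (w - q.1.x)) := by
  ext1 w; simp [joint, inX, State.setX, State.x, State.z, State.mu, State.s, State.filt]
  congr 1; simp [Prod.ext_iff]

theorem setZ_eq (F : State n p → ℝ → Vec m) (q : State n p × ℝ) (j : Fin n) :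
    (fun w => F (q.1.setZ j w) q.2) = fun w => joint F (q + inZ j (w - q.1.z j)) := by
  ext1 w
  simp [joint, inZ, State.setZ, State.x, State.z, State.mu, State.s, State.filt,
    update_eq_add_single]
  congr 1; simp [Prod.ext_iff]

theorem setMu_eq (F : State n p → ℝ → Vec m) (q : State n p × ℝ) (j : Fin n) :
    (fun w => F (q.1.setMu j w) q.2) = fun w => joint F (q + inMu j (w - q.1.mu j)) := by
  ext1 w
  simp [joint, inMu, State.setMu, State.x, State.z, State.mu, State.s, State.filt,
    update_eq_add_single]
  congr 1; simp [Prod.ext_iff]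

theorem setFilt_eq (F : State n p → ℝ → Vec m) (q : State n p × ℝ) (j : Fin n)
    (l : Fin (n - 1 - j)) :
    (fun w => F (q.1.setFilt j l w) q.2)
      = fun w => joint F (q + inFilt j l (w - q.1.filt j l)) := by
  ext1 w
  simp [joint, inFilt, State.setFilt, State.x, State.z, State.mu, State.s, State.filt,
    update_eq_add_single]
  congr 1; simp [Prod.ext_iff]

theorem time_eq (F : State n p → ℝ → Vec m) (q : State n p × ℝ) :
    (fun w => F q.1 w) = fun w => joint F (q + inTime (w - q.2)) := by
  ext1 w; simp [joint, inTime]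

section Smooth

variable {F : State n p → ℝ → Vec m} {k : ℕ} {q₀ : State n p × ℝ}

theorem contDiffAt_dX (hF : ContDiffAt ℝ (k + 1 : ℕ) (joint F) q₀) :
    ContDiffAt ℝ k (fun q : State n p × ℝ => dX F q.1 q.2) q₀ := by
  simp_rw [dX, setX_eq F]
  exact contDiffAt_fderiv_translate hF inX fun q => q.1.x

theorem contDiffAt_dZ (hF : ContDiffAt ℝ (k + 1 : ℕ) (joint F) q₀) (j : Fin n) :
    ContDiffAt ℝ k (fun q : State n p × ℝ => dZ F q.1 q.2 j) q₀ := by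
  simp_rw [dZ, setZ_eq F]
  exact contDiffAt_fderiv_translate hF (inZ j) fun q => q.1.z j

theorem contDiffAt_dMu (hF : ContDiffAt ℝ (k + 1 : ℕ) (joint F) q₀) (j : Fin n) :
    ContDiffAt ℝ k (fun q : State n p × ℝ => dMu F q.1 q.2 j) q₀ := by
  simp_rw [dMu, setMu_eq F]
  exact contDiffAt_fderiv_translate hF (inMu j) fun q => q.1.mu j

theorem contDiffAt_dFilt (hF : ContDiffAt ℝ (k + 1 : ℕ) (joint F) q₀) (j : Fin n)
    (l : Fin (n - 1 - j)) :
    ContDiffAt ℝ k (fun q : State n p × ℝ => dFilt F q.1 q.2 j l) q₀ := by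
  simp_rw [dFilt, setFilt_eq F]
  exact contDiffAt_fderiv_translate hF (inFilt j l) fun q => q.1.filt j l

theorem contDiffAt_dTime (hF : ContDiffAt ℝ (k + 1 : ℕ) (joint F) q₀) :
    ContDiffAt ℝ k (fun q : State n p × ℝ => deriv (fun t => F q.1 t) q.2) q₀ := by
  simp_rw [← fderiv_apply_one_eq_deriv, time_eq F]
  exact (contDiffAt_fderiv_translate hF inTime fun q => q.2).clm_apply contDiffAt_const

theorem State.contDiff_z {k : WithTop ℕ∞} (j : Fin n) : ContDiff ℝ k fun v : State n p => v.z j :=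
  contDiff_pi.1 contDiff_snd.fst j

theorem State.contDiff_mu {k : WithTop ℕ∞} (j : Fin n) :
    ContDiff ℝ k fun v : State n p => v.mu j :=
  contDiff_pi.1 contDiff_snd.snd.fst j

theorem State.contDiff_s {k : WithTop ℕ∞} (j : Fin n) : ContDiff ℝ k fun v : State n p => v.s j :=
  contDiff_pi.1 contDiff_snd.snd.snd.fst j

theorem State.contDiff_filt {k : WithTop ℕ∞} (j : Fin n) (l : Fin (n - 1 - j)) :
    ContDiff ℝ k fun v : State n p => v.filt j l :=
  contDiff_pi.1 (contDiff_pi.1 contDiff_snd.snd.snd.snd j) l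

theorem State.contDiff_Z {k : WithTop ℕ∞} (j : ℕ) :
    ContDiff ℝ k fun v : State n p => v.Z j := by
  cases j with
  | zero => exact contDiff_fst
  | succ j =>
    by_cases h : j < n
    · simp only [State.Z, h, dite_true]; exact State.contDiff_z _
    · simp only [State.Z, h, dite_false]; exact contDiff_const

theorem State.contDiff_upTo {k : WithTop ℕ∞} (j : ℕ) :
    ContDiff ℝ k fun v : State n p => v.upTo j :=
  contDiff_pi.2 fun i => State.contDiff_Z i

theorem State.contDiff_nth_mu {k : WithTop ℕ∞} (j : ℕ) :
    ContDiff ℝ k fun v : State n p => nth v.mu j :=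
  (contDiff_nth j).comp contDiff_snd.snd.fst

theorem State.contDiff_err {k : WithTop ℕ∞} : ContDiff ℝ k fun v : State n p => v.err :=
  (State.contDiff_Z 1).sub (State.contDiff_nth_mu 0)

theorem State.contDiff_chain {k : WithTop ℕ∞} (w : Vec (p 1)) (j : ℕ) :
    ContDiff ℝ k fun v : State n p => v.chain w j := by
  by_cases h : j < n
  · simp only [State.chain, h, dite_true]; exact State.contDiff_mu _
  · simp only [State.chain, h, dite_false]; exact contDiff_const

theorem State.contDiff_dHat {k : WithTop ℕ∞} (D : Design) (i j : ℕ) :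
    ContDiff ℝ k fun v : State n p => v.dHat D i j := by
  rcases i with _ | i
  · simp only [State.dHat]; exact contDiff_const
  rcases j with _ | j
  · by_cases h : i < n
    · simp only [State.dHat, h, dite_true]
      exact (State.contDiff_s _).add ((State.contDiff_z _).const_smul _)
    · simp only [State.dHat, h, dite_false]; exact contDiff_const
  · by_cases h : j < n - 1 - i
    · simp only [State.dHat, h, dite_true]; exact State.contDiff_filt _ _
    · simp only [State.dHat, h, dite_false]; exact contDiff_const

/-- `A ↦ Aᵀ` as a continuous `ℝ`-linear map; `ContinuousLinearMap.adjoint` itself is bundled as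
conjugate-linear. -/
noncomputable def adjointMap (a b : ℕ) : (Vec a →L[ℝ] Vec b) →L[ℝ] (Vec b →L[ℝ] Vec a) :=
  LinearMap.toContinuousLinearMap
    { toFun := fun A => ContinuousLinearMap.adjoint A
      map_add' := fun A B => map_add _ A B
      map_smul' := fun c A => by simp }

theorem contDiffAt_adjoint {E : Type*} [NormedAddCommGroup E] [NormedSpace ℝ E]
    {a b : ℕ} {k : WithTop ℕ∞} {A : E → Vec a →L[ℝ] Vec b} {q : E} (hA : ContDiffAt ℝ k A q) :
    ContDiffAt ℝ k (fun q => ContinuousLinearMap.adjoint (A q)) q :=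
  (adjointMap a b).contDiff.contDiffAt.comp q hA

theorem contDiffAt_rightInv {E : Type*} [NormedAddCommGroup E] [NormedSpace ℝ E]
    {a b : ℕ} {k : WithTop ℕ∞} {A : E → Vec a →L[ℝ] Vec b} {q : E} (hA : ContDiffAt ℝ k A q)
    (hinv : (A q ∘L ContinuousLinearMap.adjoint (A q)).IsInvertible) :
    ContDiffAt ℝ k (fun q => rightInv (A q)) q := by
  obtain ⟨e, he⟩ := hinv
  have h1 := contDiffAt_map_inverse (n := k) e
  rw [he] at h1
  exact (contDiffAt_adjoint hA).clm_comp
    (ContDiffAt.comp (g := ContinuousLinearMap.inverse) q h1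
      (hA.clm_comp (contDiffAt_adjoint hA)))

/-- If `A` has a right inverse, then `A Aᵀ` is invertible. -/
theorem isInvertible_comp_adjoint {a b : ℕ} {A : Vec a →L[ℝ] Vec b}
    (h : ∃ r : Vec b →L[ℝ] Vec a, A ∘L r = ContinuousLinearMap.id ℝ (Vec b)) :
    (A ∘L ContinuousLinearMap.adjoint A).IsInvertible := by
  obtain ⟨r, hr⟩ := h
  have hinj : Function.Injective (A ∘L ContinuousLinearMap.adjoint A).toLinearMap := by
    rw [injective_iff_map_eq_zero]
    intro y hy
    have h1 : ContinuousLinearMap.adjoint A y = 0 := by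
      have h2 : inner ℝ y (A (ContinuousLinearMap.adjoint A y)) = 0 := by
        have : A (ContinuousLinearMap.adjoint A y) = 0 := hy
        rw [this, inner_zero_right]
      rw [← ContinuousLinearMap.adjoint_inner_left] at h2
      exact inner_self_eq_zero.1 h2
    have h3 : inner ℝ (ContinuousLinearMap.adjoint A y) (r y) = 0 := by rw [h1, inner_zero_left]
    rw [ContinuousLinearMap.adjoint_inner_left] at h3
    have h4 : A (r y) = y := DFunLike.congr_fun hr y
    rw [h4] at h3
    exact inner_self_eq_zero.1 h3
  refine ⟨(LinearEquiv.ofInjectiveEndo _ hinj).toContinuousLinearEquiv, ?_⟩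
  ext1 y
  simp

theorem apply_rightInv {a b : ℕ} {A : Vec a →L[ℝ] Vec b}
    (h : (A ∘L ContinuousLinearMap.adjoint A).IsInvertible) (y : Vec b) :
    A (rightInv A y) = y := by
  obtain ⟨e, he⟩ := h
  show (A ∘L ContinuousLinearMap.adjoint A) ((A ∘L ContinuousLinearMap.adjoint A).inverse y) = y
  rw [← he]
  simp

/-- The points at which the control laws are smooth: no denominator vanishes and all
`g_k g_kᵀ` are invertible. -/
structure Regular (S : Plant p) (D : Design) (v : State n p) (t : ℝ) : Prop where
  rho_ne : D.ρ t ≠ 0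
  gap_ne : D.ρ t ^ 2 - ‖v.err‖ ^ 2 ≠ 0
  invertible : ∀ k, 1 ≤ k → k ≤ n →
    (S.g k (v.upTo k) ∘L ContinuousLinearMap.adjoint (S.g k (v.upTo k))).IsInvertible

theorem contDiffAt_nTerm {S : Plant p} {D : Design} (hS : S.IsSmooth n) (w : Vec (p 1)) {i : ℕ}
    (hk : k ≤ n + 1) (hF : ContDiffAt ℝ (k + 1 : ℕ) (joint F) q₀) :
    ContDiffAt ℝ k (fun q : State n p × ℝ => nTerm S D w i F q.1 q.2) q₀ := by
  obtain ⟨hf, hg, -, hfg⟩ := hS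
  have hkn : (k : WithTop ℕ∞) ≤ (n + 1 : WithTop ℕ∞) := by exact_mod_cast hk
  have lift : ∀ {X : Type _} [NormedAddCommGroup X] [NormedSpace ℝ X] {f : State n p → X},
      ContDiff ℝ k f → ContDiffAt ℝ k (fun q : State n p × ℝ => f q.1) q₀ :=
    fun h => (h.comp contDiff_fst).contDiffAt
  have hxc : ContDiff ℝ k fun v : State n p => v.x := contDiff_fst
  unfold nTerm
  refine ContDiffAt.add (ContDiffAt.sub (ContDiffAt.add (ContDiffAt.add (contDiffAt_dTime hF)
    (ContDiffAt.sum fun j _ => ?_)) (ContDiffAt.sum fun j _ => ?_))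
    (ContDiffAt.sum fun j _ => ContDiffAt.sum fun l _ => ?_)) ?_
  · obtain ⟨h1, h2⟩ := hfg (j + 1) (by omega) (by omega)
    refine (contDiffAt_dZ hF j).clm_apply ?_
    exact (lift ((h1.of_le hkn).comp (State.contDiff_upTo _))).add
      ((lift ((h2.of_le hkn).comp (State.contDiff_upTo _))).clm_apply (lift (State.contDiff_Z _)))
  · exact (contDiffAt_dMu hF j).clm_apply (lift (State.contDiff_chain w _))
  · exact (contDiffAt_dFilt hF j l).clm_apply (((lift (State.contDiff_dHat D _ _)).sub
      (lift (State.contDiff_dHat D _ _))).const_smul _)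
  · exact (contDiffAt_dX hF).clm_apply ((lift ((hf.of_le hkn).comp hxc)).add
      ((lift ((hg.of_le hkn).comp hxc)).clm_apply (lift (State.contDiff_Z 1))))

end Smooth

/-- The control laws are smooth at regular points; one order of differentiability is lost at each
step. -/
theorem contDiffAt_tau {S : Plant p} {D : Design} (hS : S.IsSmooth n) (hρ : ContDiff ℝ ∞ D.ρ)
    (w : Vec (p 1)) {q₀ : State n p × ℝ} (hq : Regular S D q₀.1 q₀.2) :
    ∀ (k m : ℕ), k ≤ n → k + m ≤ n + 1 → ContDiffAt ℝ m (joint (tau S D w k)) q₀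
  | 0, m, _, _ => by
    show ContDiffAt ℝ m (fun q : State n p × ℝ => nth q.1.mu 0) q₀
    exact ((State.contDiff_nth_mu 0).comp contDiff_fst).contDiffAt
  | 1, m, hk, hm => by
    have lift : ∀ {X : Type _} [NormedAddCommGroup X] [NormedSpace ℝ X] {f : State n p → X},
        ContDiff ℝ m f → ContDiffAt ℝ m (fun q : State n p × ℝ => f q.1) q₀ :=
      fun h => (h.comp contDiff_fst).contDiffAt
    have hkn : (m : WithTop ℕ∞) ≤ (n + 1 : WithTop ℕ∞) := by
      exact_mod_cast (show m ≤ n + 1 by omega)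
    have hρ0 : ContDiffAt ℝ m (fun q : State n p × ℝ => D.ρ q.2) q₀ :=
      ((hρ.of_le (by exact_mod_cast le_top)).comp contDiff_snd).contDiffAt
    have hρ1 : ContDiffAt ℝ m (fun q : State n p × ℝ => deriv D.ρ q.2) q₀ := by
      have : ContDiff ℝ ∞ (deriv D.ρ) := (contDiff_infty_iff_deriv.1 hρ).2
      exact ((this.of_le (by exact_mod_cast le_top)).comp contDiff_snd).contDiffAt
    have he : ContDiffAt ℝ m (fun q : State n p × ℝ => q.1.err) q₀ := lift State.contDiff_err
    obtain ⟨h1, h2⟩ := hS.2.2.2 1 le_rfl hk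
    show ContDiffAt ℝ m (fun q : State n p × ℝ => tau S D w 1 q.1 q.2) q₀
    unfold tau
    refine (contDiffAt_rightInv (lift ((h2.of_le hkn).comp (State.contDiff_upTo _)))
      (hq.invertible 1 le_rfl hk)).clm_apply ?_
    refine ContDiffAt.add (ContDiffAt.sub (ContDiffAt.sub (ContDiffAt.sub (ContDiffAt.sub
      ?_ ?_) ?_) ?_) ?_) ?_
    · exact (hρ1.div hρ0 hq.rho_ne).smul he
    · exact he.const_smul _
    · exact lift (State.contDiff_dHat D _ _)
    · by_cases hmar : 4 * D.margin n 1 = 0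
      · simp only [hmar, zero_mul, div_zero, zero_smul]; exact contDiffAt_const
      · exact (contDiffAt_const.div (contDiffAt_const.mul ((hρ0.pow 2).sub (he.norm_sq ℝ)))
          (mul_ne_zero hmar hq.gap_ne)).smul he
    · exact lift ((h1.of_le hkn).comp (State.contDiff_upTo _))
    · exact lift (State.contDiff_chain w _)
  | k + 2, m, hk, hm => by
    have lift : ∀ {X : Type _} [NormedAddCommGroup X] [NormedSpace ℝ X] {f : State n p → X},
        ContDiff ℝ m f → ContDiffAt ℝ m (fun q : State n p × ℝ => f q.1) q₀ :=
      fun h => (h.comp contDiff_fst).contDiffAt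
    have hkn : (m : WithTop ℕ∞) ≤ (n + 1 : WithTop ℕ∞) := by
      exact_mod_cast (show m ≤ n + 1 by omega)
    have hρ0 : ContDiffAt ℝ m (fun q : State n p × ℝ => D.ρ q.2) q₀ :=
      ((hρ.of_le (by exact_mod_cast le_top)).comp contDiff_snd).contDiffAt
    have hτ := contDiffAt_tau hS hρ w hq (k + 1) (m + 1) (by omega) (by omega)
    have hτ0 : ContDiffAt ℝ m (fun q : State n p × ℝ => tau S D w (k + 1) q.1 q.2) q₀ :=
      contDiffAt_tau hS hρ w hq (k + 1) m (by omega) (by omega)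
    have hτ1 : ContDiffAt ℝ m (fun q : State n p × ℝ => tau S D w k q.1 q.2) q₀ :=
      contDiffAt_tau hS hρ w hq k m (by omega) (by omega)
    have hε : ContDiffAt ℝ m (fun q : State n p × ℝ => q.1.Z (k + 2) - tau S D w (k + 1) q.1 q.2)
      q₀ := (lift (State.contDiff_Z _)).sub hτ0
    have hε' : ContDiffAt ℝ m (fun q : State n p × ℝ => q.1.Z (k + 1) - tau S D w k q.1 q.2)
      q₀ := (lift (State.contDiff_Z _)).sub hτ1
    obtain ⟨h1, h2⟩ := hS.2.2.2 (k + 2) (by omega) hk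
    obtain ⟨-, h3⟩ := hS.2.2.2 (k + 1) (by omega) (by omega)
    have hdZ := fun j => contDiffAt_dZ hτ j
    show ContDiffAt ℝ m (fun q : State n p × ℝ => tau S D w (k + 2) q.1 q.2) q₀
    unfold tau
    refine (contDiffAt_rightInv (lift ((h2.of_le hkn).comp (State.contDiff_upTo _)))
      (hq.invertible (k + 2) (by omega) hk)).clm_apply ?_
    refine ContDiffAt.add (ContDiffAt.sub (ContDiffAt.sub (ContDiffAt.sub (ContDiffAt.sub
      (ContDiffAt.sub (ContDiffAt.sub (ContDiffAt.sum fun j _ => ?_)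
      (ContDiffAt.sum fun j _ => ?_)) ?_) ?_) ?_) ?_) ?_) ?_
    · exact (hdZ j).clm_apply (lift (State.contDiff_dHat D _ _))
    · refine ContDiffAt.fun_smul (contDiffAt_const.mul ?_) hε
      unfold frobSq
      exact ContDiffAt.sum fun i _ => ((hdZ j).clm_apply contDiffAt_const).norm_sq ℝ
    · exact lift (State.contDiff_dHat D _ _)
    · exact lift ((h1.of_le hkn).comp (State.contDiff_upTo _))
    · exact hε.const_smul _
    · exact hε.const_smul _
    · refine (contDiffAt_adjoint
        (lift ((h3.of_le hkn).comp (State.contDiff_upTo _)))).clm_apply ?_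
      by_cases h0 : k = 0
      · subst h0
        simp only [if_true]
        exact (contDiffAt_const.div ((hρ0.pow 2).sub (hε'.norm_sq ℝ)) hq.gap_ne).smul hε'
      · simp only [h0, if_false]; exact hε'
    · exact contDiffAt_nTerm hS w (by omega) hτ

end ControllerCalculus

/-! ### Variables on which the control laws depend -/

section ControllerTrajectory

variable {n : ℕ} {p : ℕ → ℕ}

/-- `v` and `v'` agree in the variables on which `τ_k` depends: `x`, `z_1, …, z_k`,
`μ_1, …, μ_{k+1}` and the filter states `d̂^f_{j,l}` with `j ≤ k` and `l ≥ n - k`. -/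
structure Agree (k : ℕ) (v v' : State n p) : Prop where
  x_eq : v.x = v'.x
  z_eq : ∀ j : Fin n, j.val < k → v.z j = v'.z j
  mu_eq : ∀ j : Fin n, j.val ≤ k → v.mu j = v'.mu j
  filt_eq : ∀ (j : Fin n) (l : Fin (n - 1 - j)), j.val < k → n ≤ l.val + 1 + k →
    v.filt j l = v'.filt j l

namespace Agree

variable {k : ℕ} {v v' : State n p}

theorem mono {i : ℕ} (h : Agree k v v') (hik : i ≤ k) : Agree i v v' where
  x_eq := h.x_eq
  z_eq j hj := h.z_eq j (by omega)
  mu_eq j hj := h.mu_eq j (by omega)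
  filt_eq j l hj hl := h.filt_eq j l (by omega) (by omega)

theorem setX (h : Agree k v v') (w : Vec (p 0)) : Agree k (v.setX w) (v'.setX w) :=
  ⟨rfl, h.z_eq, h.mu_eq, h.filt_eq⟩

theorem setZ (h : Agree k v v') (i : Fin n) (w : Vec (p (i + 1))) :
    Agree k (v.setZ i w) (v'.setZ i w) := by
  refine ⟨h.x_eq, fun j hj => ?_, h.mu_eq, h.filt_eq⟩
  show Function.update v.z i w j = Function.update v'.z i w j
  by_cases hji : j = i
  · subst hji; simp
  · simp [hji, h.z_eq j hj]

theorem setMu (h : Agree k v v') (i : Fin n) (w : Vec (p 1)) :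
    Agree k (v.setMu i w) (v'.setMu i w) := by
  refine ⟨h.x_eq, h.z_eq, fun j hj => ?_, h.filt_eq⟩
  show Function.update v.mu i w j = Function.update v'.mu i w j
  by_cases hji : j = i
  · subst hji; simp
  · simp [hji, h.mu_eq j hj]

theorem setFilt (h : Agree k v v') (i : Fin n) (r : Fin (n - 1 - i)) (w : Vec (p (i + 1))) :
    Agree k (v.setFilt i r w) (v'.setFilt i r w) := by
  refine ⟨h.x_eq, h.z_eq, h.mu_eq, fun j l hj hl => ?_⟩
  show Function.update v.filt i (Function.update (v.filt i) r w) j l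
    = Function.update v'.filt i (Function.update (v'.filt i) r w) j l
  by_cases hji : j = i
  · subst hji
    by_cases hlr : l = r
    · subst hlr; simp
    · simp [hlr, h.filt_eq j l hj hl]
  · simp [hji, h.filt_eq j l hj hl]

theorem Z (h : Agree k v v') {j : ℕ} (hj : j ≤ k) : v.Z j = v'.Z j := by
  cases j with
  | zero => exact h.x_eq
  | succ j =>
    by_cases hjn : j < n
    · simp only [State.Z, hjn, dite_true]; exact h.z_eq _ (by simpa using hj)
    · simp only [State.Z, hjn, dite_false]

theorem upTo (h : Agree k v v') {j : ℕ} (hj : j ≤ k) : v.upTo j = v'.upTo j :=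
  funext fun i => h.Z (by omega)

theorem nth_mu (h : Agree k v v') {j : ℕ} (hj : j ≤ k) : nth v.mu j = nth v'.mu j := by
  by_cases hjn : j < n
  · simp only [nth_of_lt _ hjn]; exact h.mu_eq _ hj
  · simp [nth, hjn]

theorem chain (h : Agree k v v') (w : Vec (p 1)) {j : ℕ} (hj : j ≤ k) :
    v.chain w j = v'.chain w j := by
  by_cases hjn : j < n
  · simp only [State.chain, hjn, dite_true]; exact h.mu_eq _ hj
  · simp [State.chain, hjn]

theorem dHat (h : Agree k v v') (D : Design) {i j : ℕ} (hi : i ≤ k) (hj0 : 0 < j)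
    (hj : n ≤ j + k) : v.dHat D i j = v'.dHat D i j := by
  rcases i with _ | i
  · rfl
  rcases j with _ | j
  · omega
  by_cases hjn : j < n - 1 - i
  · simp only [State.dHat, hjn, dite_true]; exact h.filt_eq _ _ (by simpa using hi) hj
  · simp [State.dHat, hjn]

end Agree

variable {m : ℕ} {k : ℕ} {F : State n p → ℝ → Vec m} {v v' : State n p} {t : ℝ}

theorem dX_congr (hF : ∀ v v', Agree k v v' → F v t = F v' t) (h : Agree k v v') :
    dX F v t = dX F v' t := by
  unfold dX
  rw [h.x_eq]
  congr 1
  ext1 w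
  exact hF _ _ (h.setX w)

theorem dZ_congr (hF : ∀ v v', Agree k v v' → F v t = F v' t) (h : Agree k v v') {j : Fin n}
    (hj : j.val < k) : dZ F v t j = dZ F v' t j := by
  unfold dZ
  rw [h.z_eq j hj]
  congr 1
  ext1 w
  exact hF _ _ (h.setZ j w)

theorem dMu_congr (hF : ∀ v v', Agree k v v' → F v t = F v' t) (h : Agree k v v') {j : Fin n}
    (hj : j.val ≤ k) : dMu F v t j = dMu F v' t j := by
  unfold dMu
  rw [h.mu_eq j hj]
  congr 1
  ext1 w
  exact hF _ _ (h.setMu j w)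

theorem dFilt_congr (hF : ∀ v v', Agree k v v' → F v t = F v' t) (h : Agree k v v') {j : Fin n}
    {l : Fin (n - 1 - j)} (hj : j.val < k) (hl : n ≤ l.val + 1 + k) :
    dFilt F v t j l = dFilt F v' t j l := by
  unfold dFilt
  rw [h.filt_eq j l hj hl]
  congr 1
  ext1 w
  exact hF _ _ (h.setFilt j l w)

theorem nTerm_congr (S : Plant p) (D : Design) (w : Vec (p 1)) {i : ℕ} (hi : i + 1 < n)
    (hF : ∀ t v v', Agree i v v' → F v t = F v' t) (h : Agree (i + 1) v v') :
    nTerm S D w (i + 1) F v t = nTerm S D w (i + 1) F v' t := by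
  have h' := h.mono (Nat.le_succ i)
  unfold nTerm
  congr 1
  · congr 1
    · congr 1
      · congr 1
        · congr 1
          ext1 t'
          exact hF _ _ _ h'
        · refine Finset.sum_congr rfl fun j hj => ?_
          have hj' : j.val + 1 < i + 1 := by simpa using hj
          rw [dZ_congr (hF t) h' (by omega), h.upTo (by omega), h.Z (by omega)]
      · refine Finset.sum_congr rfl fun j hj => ?_
        have hj' : j.val < i + 1 := by simpa using hj
        rw [dMu_congr (hF t) h' (by omega), h.chain w (by omega)]
    · refine Finset.sum_congr rfl fun j hj => Finset.sum_congr rfl fun l hl => ?_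
      have hj' : j.val + 1 < i + 1 := by simpa using hj
      have hl' : n < l.val + 1 + (i + 1) := by simpa using hl
      rw [dFilt_congr (hF t) h' (by omega) (by omega), h.dHat D (by omega) (by omega) (by omega),
        h.dHat D (by omega) (by omega) (by omega)]
  · rw [dX_congr (hF t) h', h.x_eq, h.Z (by omega)]

/-- `τ_k`, `k < n`, depends only on the variables listed in `Agree k`; in particular it does not
depend on the observer states. -/
theorem tau_congr (S : Plant p) (D : Design) (w : Vec (p 1)) :
    ∀ (k : ℕ), k < n → ∀ (t : ℝ) (v v' : State n p), Agree k v v' →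
      tau S D w k v t = tau S D w k v' t
  | 0, _, t, v, v', h => h.nth_mu le_rfl
  | 1, hk, t, v, v', h => by
    have he : v.err = v'.err := by rw [State.err, State.err, h.Z le_rfl, h.nth_mu (by omega)]
    unfold tau
    rw [he, h.upTo le_rfl, h.chain w le_rfl, h.dHat D le_rfl (by omega) (by omega)]
  | k + 2, hk, t, v, v', h => by
    have ih1 := tau_congr S D w (k + 1) (by omega)
    have ih0 := tau_congr S D w k (by omega)
    have h1 : Agree (k + 1) v v' := h.mono (by omega)
    have hdZ : ∀ j : Fin n, j.val + 1 < k + 2 →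
        dZ (tau S D w (k + 1)) v t j = dZ (tau S D w (k + 1)) v' t j := fun j hj =>
      dZ_congr (ih1 t) h1 (by omega)
    unfold tau
    dsimp only
    rw [nTerm_congr S D w hk ih1 h, h.upTo le_rfl, h.upTo (show k + 1 ≤ k + 2 by omega),
      h.dHat D le_rfl (by omega) (by omega), ih1 t v v' h1, ih0 t v v' (h.mono (by omega)),
      h.Z le_rfl, h.Z (show k + 1 ≤ k + 2 by omega)]
    have s1 : ∑ j : Fin n with j.val + 1 < k + 2,
          dZ (tau S D w (k + 1)) v t j (v.dHat D (j + 1) (n - (j + 1)))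
        = ∑ j : Fin n with j.val + 1 < k + 2,
          dZ (tau S D w (k + 1)) v' t j (v'.dHat D (j + 1) (n - (j + 1))) :=
      Finset.sum_congr rfl fun j hj => by
        have hj' : j.val + 1 < k + 2 := by simpa using hj
        rw [hdZ j hj', h.dHat D (by omega) (by omega) (by omega)]
    have s2 : ∀ ε : Vec (p (k + 2)), ∑ j : Fin n with j.val + 1 < k + 2,
          (((n : ℝ) - ((j : ℝ) + 1) + 1) / (4 * D.γ (j + 1))
            * frobSq (dZ (tau S D w (k + 1)) v t j)) • ε
        = ∑ j : Fin n with j.val + 1 < k + 2,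
          (((n : ℝ) - ((j : ℝ) + 1) + 1) / (4 * D.γ (j + 1))
            * frobSq (dZ (tau S D w (k + 1)) v' t j)) • ε := fun ε =>
      Finset.sum_congr rfl fun j hj => by
        have hj' : j.val + 1 < k + 2 := by simpa using hj
        rw [hdZ j hj']
    rw [s1, s2]

/-- The proxy control enters in `τ_n` only. -/
theorem tau_proxy_irrel (S : Plant p) (D : Design) (w w' : Vec (p 1)) :
    ∀ (k : ℕ), k < n → (tau S D w k : State n p → ℝ → Vec (p (k + 1))) = tau S D w' k
  | 0, _ => rfl
  | 1, hk => by
    ext1 v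
    ext1 t
    unfold tau
    simp only [State.chain, hk, dite_true]
  | k + 2, hk => by
    have hN : ∀ (F : State n p → ℝ → Vec (p (k + 2))) (v : State n p) (t : ℝ),
        nTerm S D w (k + 2) F v t = nTerm S D w' (k + 2) F v t := by
      intro F v t
      unfold nTerm
      congr 3
      refine Finset.sum_congr rfl fun j hj => ?_
      have hj' : j.val < k + 2 := by simpa using hj
      simp only [State.chain, show j.val + 1 < n by omega, dite_true]
    ext1 v
    ext1 t
    unfold tau
    dsimp only
    rw [tau_proxy_irrel S D w w' (k + 1) (by omega), tau_proxy_irrel S D w w' k (by omega), hN]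

end ControllerTrajectory

/-! ### Control laws along closed-loop solutions -/

section ControllerChainRule

variable {n : ℕ} {p : ℕ → ℕ} {m k : ℕ} {F : State n p → ℝ → Vec m}

theorem dZ_eq_zero {v : State n p} {t : ℝ} (hF : ∀ v v', Agree k v v' → F v t = F v' t)
    {j : Fin n} (hj : k ≤ j.val) : dZ F v t j = 0 := by
  have : (fun w => F (v.setZ j w) t) = fun _ => F v t := by
    ext1 w
    refine hF _ _ ⟨rfl, fun i hi => ?_, fun _ _ => rfl, fun _ _ _ _ => rfl⟩
    exact Function.update_of_ne (by rintro rfl; omega) _ _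
  simp [dZ, this]

theorem dMu_eq_zero {v : State n p} {t : ℝ} (hF : ∀ v v', Agree k v v' → F v t = F v' t)
    {j : Fin n} (hj : k < j.val) : dMu F v t j = 0 := by
  have : (fun w => F (v.setMu j w) t) = fun _ => F v t := by
    ext1 w
    refine hF _ _ ⟨rfl, fun _ _ => rfl, fun i hi => ?_, fun _ _ _ _ => rfl⟩
    exact Function.update_of_ne (by rintro rfl; omega) _ _
  simp [dMu, this]

theorem dFilt_eq_zero {v : State n p} {t : ℝ} (hF : ∀ v v', Agree k v v' → F v t = F v' t)
    {j : Fin n} {l : Fin (n - 1 - j)} (h : ¬ (j.val < k ∧ n ≤ l.val + 1 + k)) :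
    dFilt F v t j l = 0 := by
  have : (fun w => F (v.setFilt j l w) t) = fun _ => F v t := by
    ext1 w
    refine hF _ _ ⟨rfl, fun _ _ => rfl, fun _ _ => rfl, fun i r hi hr => ?_⟩
    show Function.update v.filt j (Function.update (v.filt j) l w) i r = v.filt i r
    by_cases hij : i = j
    · subst hij
      rw [Function.update_self, Function.update_of_ne]
      rintro rfl
      exact h ⟨hi, hr⟩
    · rw [Function.update_of_ne hij]
  simp [dFilt, this]

theorem fderiv_comp_inS_eq_zero {q : State n p × ℝ}
    (hF : ∀ v v', Agree k v v' → F v q.2 = F v' q.2)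
    (hd : DifferentiableAt ℝ (joint F) q) (j : Fin n) :
    fderiv ℝ (joint F) q ∘L inS j = 0 := by
  rw [← fderiv_translate hd (inS j) (q.1.s j)]
  have : (fun w => joint F (q + inS j (w - q.1.s j))) = fun _ => F q.1 q.2 := by
    ext1 w
    have h2 : (q + inS j (w - q.1.s j)).2 = q.2 := by simp [inS]
    rw [joint, h2]
    refine hF _ _ ⟨?_, fun _ _ => ?_, fun _ _ => ?_, fun _ _ _ _ => ?_⟩ <;>
      simp [inS, State.x, State.z, State.mu, State.filt]
  rw [this]
  exact (hasFDerivAt_const _ _).fderiv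

theorem dX_eq_fderiv {q : State n p × ℝ} (hd : DifferentiableAt ℝ (joint F) q) :
    dX F q.1 q.2 = fderiv ℝ (joint F) q ∘L inX := by
  rw [dX, setX_eq F q]; exact fderiv_translate hd inX q.1.x

theorem dZ_eq_fderiv {q : State n p × ℝ} (hd : DifferentiableAt ℝ (joint F) q) (j : Fin n) :
    dZ F q.1 q.2 j = fderiv ℝ (joint F) q ∘L inZ j := by
  rw [dZ, setZ_eq F q]; exact fderiv_translate hd (inZ j) (q.1.z j)

theorem dMu_eq_fderiv {q : State n p × ℝ} (hd : DifferentiableAt ℝ (joint F) q) (j : Fin n) :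
    dMu F q.1 q.2 j = fderiv ℝ (joint F) q ∘L inMu j := by
  rw [dMu, setMu_eq F q]; exact fderiv_translate hd (inMu j) (q.1.mu j)

theorem dFilt_eq_fderiv {q : State n p × ℝ} (hd : DifferentiableAt ℝ (joint F) q) (j : Fin n)
    (l : Fin (n - 1 - j)) : dFilt F q.1 q.2 j l = fderiv ℝ (joint F) q ∘L inFilt j l := by
  rw [dFilt, setFilt_eq F q]; exact fderiv_translate hd (inFilt j l) (q.1.filt j l)

theorem dTime_eq_fderiv {q : State n p × ℝ} (hd : DifferentiableAt ℝ (joint F) q) :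
    deriv (fun r => F q.1 r) q.2 = fderiv ℝ (joint F) q (inTime 1) := by
  rw [← fderiv_apply_one_eq_deriv, time_eq F q, fderiv_translate hd inTime q.2]; rfl

theorem sum_inZ (z : (i : Fin n) → Vec (p (i + 1))) :
    ∑ j, inZ j (z j) = (((0, z, 0, 0, 0), 0) : State n p × ℝ) := by
  simp only [inZ, ContinuousLinearMap.comp_apply, ← map_sum, ContinuousLinearMap.single_apply,
    Finset.univ_sum_single]
  rfl

theorem sum_inMu (μ : Fin n → Vec (p 1)) :
    ∑ j, inMu j (μ j) = (((0, 0, μ, 0, 0), 0) : State n p × ℝ) := by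
  simp only [inMu, ContinuousLinearMap.comp_apply, ← map_sum, ContinuousLinearMap.single_apply,
    Finset.univ_sum_single]
  rfl

theorem sum_inS (s : (i : Fin n) → Vec (p (i + 1))) :
    ∑ j, inS j (s j) = (((0, 0, 0, s, 0), 0) : State n p × ℝ) := by
  simp only [inS, ContinuousLinearMap.comp_apply, ← map_sum, ContinuousLinearMap.single_apply,
    Finset.univ_sum_single]
  rfl

theorem sum_inFilt (φ : (i : Fin n) → Fin (n - 1 - i) → Vec (p (i + 1))) :
    ∑ j, ∑ l, inFilt j l (φ j l) = (((0, 0, 0, 0, φ), 0) : State n p × ℝ) := by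
  simp only [inFilt, ContinuousLinearMap.comp_apply, ← map_sum]
  simp only [ContinuousLinearMap.single_apply, Finset.univ_sum_single]
  rfl

theorem map_add_sums {E G ι : Type*} {κ : ι → Type*} [NormedAddCommGroup E] [NormedSpace ℝ E]
    [NormedAddCommGroup G] [NormedSpace ℝ G] [Fintype ι] [∀ i, Fintype (κ i)] (A : E →L[ℝ] G)
    (a f : E) (b c d : ι → E) (e : (i : ι) → κ i → E) :
    A (a + ∑ i, b i + ∑ i, c i + ∑ i, d i + ∑ i, ∑ j, e i j + f)
      = A a + ∑ i, A (b i) + ∑ i, A (c i) + ∑ i, A (d i) + ∑ i, ∑ j, A (e i j) + A f := by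
  simp only [map_add, map_sum]

set_option maxHeartbeats 800000 in
/-- Total derivative along a trajectory of a function that does not depend on the observer
states. -/
theorem hasDerivWithinAt_trajectory {I : Set ℝ} {t : ℝ} {v : ℝ → State n p} {x' : Vec (p 0)}
    {z' s' : (i : Fin n) → Vec (p (i + 1))} {μ' : Fin n → Vec (p 1)}
    {φ' : (i : Fin n) → Fin (n - 1 - i) → Vec (p (i + 1))}
    (hF : ∀ v v', Agree k v v' → F v t = F v' t)
    (hd : DifferentiableAt ℝ (joint F) (v t, t))
    (hx : HasDerivWithinAt (fun r => (v r).x) x' I t)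
    (hz : ∀ i, HasDerivWithinAt (fun r => (v r).z i) (z' i) I t)
    (hμ : ∀ i, HasDerivWithinAt (fun r => (v r).mu i) (μ' i) I t)
    (hs : ∀ i, HasDerivWithinAt (fun r => (v r).s i) (s' i) I t)
    (hφ : ∀ i j, HasDerivWithinAt (fun r => (v r).filt i j) (φ' i j) I t) :
    HasDerivWithinAt (fun r => F (v r) r)
      (dX F (v t) t x' + ∑ j, dZ F (v t) t j (z' j) + ∑ j, dMu F (v t) t j (μ' j)
        + ∑ j, ∑ l, dFilt F (v t) t j l (φ' j l) + deriv (fun r => F (v t) r) t) I t := by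
  set q : State n p × ℝ := (v t, t) with hq
  have hγ : HasDerivWithinAt (fun r => ((v r, r) : State n p × ℝ))
      ((x', z', μ', s', φ'), 1) I t :=
    (hx.prodMk ((hasDerivWithinAt_pi.2 hz).prodMk ((hasDerivWithinAt_pi.2 hμ).prodMk
      ((hasDerivWithinAt_pi.2 hs).prodMk
        (hasDerivWithinAt_pi.2 fun i => hasDerivWithinAt_pi.2 (hφ i)))))).prodMk
      (hasDerivWithinAt_id t I)
  have hmain := HasFDerivAt.comp_hasDerivWithinAt t (f := fun r => ((v r, r) : State n p × ℝ))
    hd.hasFDerivAt hγ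
  have hdec : (((x', z', μ', s', φ'), 1) : State n p × ℝ) = inX x' + ∑ j, inZ j (z' j)
      + ∑ j, inMu j (μ' j) + ∑ j, inS j (s' j) + ∑ j, ∑ l, inFilt j l (φ' j l) + inTime 1 := by
    rw [sum_inZ, sum_inMu, sum_inS, sum_inFilt]
    simp [inX, inTime, -Prod.mk_eq_zero]
  have e6 : ∑ j, fderiv ℝ (joint F) q (inS j (s' j)) = 0 := Finset.sum_eq_zero fun j _ => by
    rw [← ContinuousLinearMap.comp_apply, fderiv_comp_inS_eq_zero (q := q) hF hd j]; rfl
  refine hmain.congr_deriv ?_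
  rw [hdec, map_add_sums, e6, add_zero]
  change _ = dX F q.1 q.2 x' + ∑ j, dZ F q.1 q.2 j (z' j) + ∑ j, dMu F q.1 q.2 j (μ' j)
        + ∑ j, ∑ l, dFilt F q.1 q.2 j l (φ' j l) + deriv (fun r => F q.1 r) q.2
  simp only [dX_eq_fderiv hd, dZ_eq_fderiv hd, dMu_eq_fderiv hd, dFilt_eq_fderiv hd,
    dTime_eq_fderiv hd, ContinuousLinearMap.comp_apply]

/-- Along a closed-loop solution the derivative of `τ_k` is the known term `𝒩_{k+1}` plus the
contribution of the disturbances. -/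
theorem tau_hasDerivWithinAt {S : Plant p} {D : Design} (hS : S.IsSmooth n)
    (hρ : ContDiff ℝ ∞ D.ρ) {ν : State n p × ℝ → Vec (p 1)} {d : (k : ℕ) → ℝ → Vec (p k)}
    {I : Set ℝ} {v : ℝ → State n p} (hv : IsClosedLoop S D ν d I v) {t : ℝ} (ht : t ∈ I)
    (hreg : Regular S D (v t) t) (w : Vec (p 1)) (hk : k < n) :
    HasDerivWithinAt (fun r => tau S D w k (v r) r)
      (nTerm S D (ν (v t, t)) (k + 1) (tau S D w k) (v t) t
        + ∑ j : Fin n with j.val + 1 < k + 1, dZ (tau S D w k) (v t) t j (d (j + 1) t)) I t := by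
  have hF := tau_congr S D w k hk t
  have hd : DifferentiableAt ℝ (joint (tau S D w k)) (v t, t) :=
    (contDiffAt_tau hS hρ w hreg k 1 (by omega) (by omega)).differentiableAt (by simp)
  refine (hasDerivWithinAt_trajectory hF hd (hv.x_eq t ht) (hv.z_eq t ht) (hv.mu_eq t ht)
    (hv.s_eq t ht) (hv.filt_eq t ht)).congr_deriv ?_
  have s1 : ∀ z' : (i : Fin n) → Vec (p (i + 1)), ∑ j, dZ (tau S D w k) (v t) t j (z' j)
      = ∑ j : Fin n with j.val + 1 < k + 1, dZ (tau S D w k) (v t) t j (z' j) := fun z' => by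
    symm
    refine Finset.sum_subset (Finset.filter_subset _ _) fun j _ hj => ?_
    have hj' : ¬ j.val + 1 < k + 1 := by simpa using hj
    rw [dZ_eq_zero hF (by omega)]; rfl
  have s2 : ∀ μ' : Fin n → Vec (p 1), ∑ j, dMu (tau S D w k) (v t) t j (μ' j)
      = ∑ j : Fin n with j.val < k + 1, dMu (tau S D w k) (v t) t j (μ' j) := fun μ' => by
    symm
    refine Finset.sum_subset (Finset.filter_subset _ _) fun j _ hj => ?_
    have hj' : ¬ j.val < k + 1 := by simpa using hj
    rw [dMu_eq_zero hF (by omega)]; rfl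
  have s3 : ∀ φ' : (i : Fin n) → Fin (n - 1 - i) → Vec (p (i + 1)),
      ∑ j, ∑ l, dFilt (tau S D w k) (v t) t j l (φ' j l)
      = ∑ j : Fin n with j.val + 1 < k + 1, ∑ l : Fin (n - 1 - j) with n < l.val + 1 + (k + 1),
        dFilt (tau S D w k) (v t) t j l (φ' j l) := fun φ' => by
    symm
    refine Finset.sum_subset_zero_on_sdiff (Finset.filter_subset _ _) (fun j hj => ?_)
      fun j hj => ?_
    · have hj' : ¬ j.val + 1 < k + 1 := by simpa using hj
      exact Finset.sum_eq_zero fun l _ => by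
        rw [dFilt_eq_zero hF (by omega)]; rfl
    · refine Finset.sum_subset (Finset.filter_subset _ _) fun l _ hl => ?_
      have hl' : ¬ n < l.val + 1 + (k + 1) := by simpa using hl
      rw [dFilt_eq_zero hF (by omega)]; rfl
  have s4 : ∑ j : Fin n with j.val + 1 < k + 1, dZ (tau S D w k) (v t) t j
        (S.f (j + 1) ((v t).upTo (j + 1)) + S.g (j + 1) ((v t).upTo (j + 1))
          (stageInput S D (ν (v t, t)) (v t) t (j + 1)) + d (j + 1) t)
      = ∑ j : Fin n with j.val + 1 < k + 1, dZ (tau S D w k) (v t) t j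
        (S.f (j + 1) ((v t).upTo (j + 1)) + S.g (j + 1) ((v t).upTo (j + 1)) ((v t).Z (j + 2)))
        + ∑ j : Fin n with j.val + 1 < k + 1, dZ (tau S D w k) (v t) t j (d (j + 1) t) := by
    rw [← Finset.sum_add_distrib]
    refine Finset.sum_congr rfl fun j hj => ?_
    have hj' : j.val + 1 < k + 1 := by simpa using hj
    rw [stageInput, if_pos (by omega), map_add]
  rw [s1, s2, s3, s4, nTerm]
  simp only [map_neg, Finset.sum_neg_distrib]
  abel

end ControllerChainRule

/-! ### Young-type estimates and error dynamics -/

section Young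

theorem norm_sq_apply_le_frobSq {a b : ℕ} (A : Vec a →L[ℝ] Vec b) (w : Vec a) :
    ‖A w‖ ^ 2 ≤ frobSq A * ‖w‖ ^ 2 := by
  have h1 : A w = ∑ i, w i • A (EuclideanSpace.single i 1) := by
    conv_lhs => rw [← (EuclideanSpace.basisFun (Fin a) ℝ).sum_repr w]
    simp
  have h2 : ‖A w‖ ≤ ∑ i, ‖w i‖ * ‖A (EuclideanSpace.single i 1)‖ := by
    rw [h1]
    exact (norm_sum_le _ _).trans_eq (Finset.sum_congr rfl fun i _ => norm_smul _ _)
  calc ‖A w‖ ^ 2 ≤ (∑ i, ‖w i‖ * ‖A (EuclideanSpace.single i 1)‖) ^ 2 :=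
        pow_le_pow_left₀ (norm_nonneg _) h2 2
    _ ≤ (∑ i, ‖w i‖ ^ 2) * ∑ i, ‖A (EuclideanSpace.single i 1)‖ ^ 2 :=
        Finset.sum_mul_sq_le_sq_mul_sq _ _ _
    _ = frobSq A * ‖w‖ ^ 2 := by rw [EuclideanSpace.norm_sq_eq w, frobSq, mul_comm]

theorem inner_le_young {b : ℕ} (u δ : Vec b) {c M : ℝ} (hc : 0 < c) (hM : ‖δ‖ ≤ M) :
    inner ℝ u δ ≤ c * ‖u‖ ^ 2 + M ^ 2 / (4 * c) := by
  have h1 : inner ℝ u δ ≤ ‖u‖ * M :=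
    (real_inner_le_norm u δ).trans (mul_le_mul_of_nonneg_left hM (norm_nonneg _))
  have h2 : c * ‖u‖ ^ 2 + M ^ 2 / (4 * c) - ‖u‖ * M = (2 * c * ‖u‖ - M) ^ 2 / (4 * c) := by
    field_simp; ring
  have h3 : 0 ≤ (2 * c * ‖u‖ - M) ^ 2 / (4 * c) := by positivity
  linarith

theorem inner_apply_le_young {a b : ℕ} (A : Vec a →L[ℝ] Vec b) (u : Vec b) (δ : Vec a) {c M : ℝ}
    (hc : 0 < c) (hM : ‖δ‖ ≤ M) :
    inner ℝ u (A δ) ≤ c * frobSq A * ‖u‖ ^ 2 + M ^ 2 / (4 * c) := by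
  have hF : 0 ≤ frobSq A := Finset.sum_nonneg fun i _ => sq_nonneg _
  have hM0 : 0 ≤ M := (norm_nonneg _).trans hM
  set r := Real.sqrt (frobSq A) with hr
  have hr2 : r ^ 2 = frobSq A := Real.sq_sqrt hF
  have hA : ‖A δ‖ ≤ r * M := by
    refine abs_le_of_sq_le_sq' ?_ (by positivity) |>.2
    rw [mul_pow, hr2]
    exact (norm_sq_apply_le_frobSq A δ).trans
      (mul_le_mul_of_nonneg_left (pow_le_pow_left₀ (norm_nonneg _) hM 2) hF)
  have h1 : inner ℝ u (A δ) ≤ ‖u‖ * (r * M) :=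
    (real_inner_le_norm u _).trans (mul_le_mul_of_nonneg_left hA (norm_nonneg _))
  have h2 : c * r ^ 2 * ‖u‖ ^ 2 + M ^ 2 / (4 * c) - ‖u‖ * (r * M)
      = (2 * c * r * ‖u‖ - M) ^ 2 / (4 * c) := by
    field_simp; ring
  have h3 : 0 ≤ (2 * c * r * ‖u‖ - M) ^ 2 / (4 * c) := by positivity
  rw [← hr2]
  linarith

end Young

section Lyapunov

variable {n : ℕ} {p : ℕ → ℕ}

/-- The tracking error `ε_{k+1} = z_{k+1} - τ_k`. For `k < n` the value of the proxy control in
`τ_k` is irrelevant and is set to `0`. -/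
noncomputable def eps (S : Plant p) (D : Design) (k : ℕ) (v : State n p) (t : ℝ) :
    Vec (p (k + 1)) :=
  v.Z (k + 1) - tau S D 0 k v t

/-- `ε_{k+1}` for `k < n`, and `ε_{n+1} = 0`. -/
noncomputable def epsNext (S : Plant p) (D : Design) (k : ℕ) (v : State n p) (t : ℝ) :
    Vec (p (k + 1)) :=
  if k < n then eps S D k v t else 0

/-- The vector `l_{k+2}`: it is `e / (ρ² - ‖e‖²)` for `k = 0` and `ε_{k+1}` otherwise. -/
noncomputable def lVec (S : Plant p) (D : Design) (k : ℕ) (v : State n p) (t : ℝ) :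
    Vec (p (k + 1)) :=
  if k = 0 then (1 / (D.ρ t ^ 2 - ‖eps S D k v t‖ ^ 2)) • eps S D k v t else eps S D k v t

/-- The coupling `⟪g_k ε_{k+1}, l_{k+1}⟫` of two successive backstepping levels. -/
noncomputable def coupling (S : Plant p) (D : Design) : ℕ → State n p → ℝ → ℝ
  | 0, _, _ => 0
  | k + 1, v, t => inner ℝ (S.g (k + 1) (v.upTo (k + 1)) (epsNext S D (k + 1) v t)) (lVec S D k v t)

/-- The part of the Lyapunov function belonging to `ε_{k+1}`: the logarithmic barrier
`½ log (ρ² / (ρ² - ‖e‖²))` for `k = 0`, and `½ ‖ε_{k+1}‖²` otherwise. -/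
noncomputable def lyap (S : Plant p) (D : Design) : ℕ → State n p → ℝ → ℝ
  | 0, v, t => Real.log (D.ρ t) - 1 / 2 * Real.log (D.ρ t ^ 2 - ‖v.err‖ ^ 2)
  | k + 1, v, t => 1 / 2 * ‖eps S D (k + 1) v t‖ ^ 2

theorem stageInput_eq (S : Plant p) (D : Design) (w : Vec (p 1)) (v : State n p) (t : ℝ) (k : ℕ) :
    stageInput S D w v t k = tau S D w k v t + epsNext S D k v t := by
  by_cases h : k < n
  · rw [stageInput, if_pos h, epsNext, if_pos h, eps, tau_proxy_irrel S D w 0 k h]; abel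
  · rw [stageInput, if_neg h, epsNext, if_neg h, add_zero]

theorem IsClosedLoop.hasDerivWithinAt_Z {S : Plant p} {D : Design}
    {ν : State n p × ℝ → Vec (p 1)} {d : (k : ℕ) → ℝ → Vec (p k)} {I : Set ℝ} {v : ℝ → State n p}
    (hv : IsClosedLoop S D ν d I v) {t : ℝ} (ht : t ∈ I) {k : ℕ} (hk : k < n) :
    HasDerivWithinAt (fun r => (v r).Z (k + 1))
      (S.f (k + 1) ((v t).upTo (k + 1)) + S.g (k + 1) ((v t).upTo (k + 1))
        (tau S D (ν (v t, t)) (k + 1) (v t) t + epsNext S D (k + 1) (v t) t) + d (k + 1) t) I t := by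
  rw [← stageInput_eq]
  have := hv.z_eq t ht ⟨k, hk⟩
  simpa only [State.Z, hk, dite_true] using this

/-- Closed-loop dynamics of `e = ε_1`. -/
theorem err_hasDerivWithinAt {S : Plant p} {D : Design} (hn : 0 < n)
    {ν : State n p × ℝ → Vec (p 1)} {d : (k : ℕ) → ℝ → Vec (p k)}
    {I : Set ℝ} {v : ℝ → State n p} (hv : IsClosedLoop S D ν d I v) {t : ℝ} (ht : t ∈ I)
    (hreg : Regular S D (v t) t) :
    HasDerivWithinAt (fun r => (v r).err)
      ((deriv D.ρ t / D.ρ t) • (v t).err - D.k 1 • (v t).err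
        - ((n : ℝ) / (4 * D.margin n 1 * (D.ρ t ^ 2 - ‖(v t).err‖ ^ 2))) • (v t).err
        + S.g 1 ((v t).upTo 1) (epsNext S D 1 (v t) t)
        + (d 1 t - (v t).dHat D 1 (n - 1))) I t := by
  have h1 : HasDerivWithinAt (fun r => (v r).Z 1)
      (S.f 1 ((v t).upTo 1) + S.g 1 ((v t).upTo 1)
        (tau S D (ν (v t, t)) 1 (v t) t + epsNext S D 1 (v t) t) + d 1 t) I t :=
    hv.hasDerivWithinAt_Z ht hn
  have h2 : HasDerivWithinAt (fun r => nth (v r).mu 0) ((v t).chain (ν (v t, t)) 1) I t := by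
    simp only [nth_of_lt _ hn]
    exact hv.mu_eq t ht ⟨0, hn⟩
  refine (h1.sub h2).congr_deriv ?_
  rw [map_add, tau, apply_rightInv (hreg.invertible 1 le_rfl hn)]
  abel

/-- Closed-loop dynamics of `ε_{k+2}`. -/
theorem eps_hasDerivWithinAt {S : Plant p} {D : Design} (hS : S.IsSmooth n)
    (hρ : ContDiff ℝ ∞ D.ρ) {ν : State n p × ℝ → Vec (p 1)} {d : (k : ℕ) → ℝ → Vec (p k)}
    {I : Set ℝ} {v : ℝ → State n p} (hv : IsClosedLoop S D ν d I v) {t : ℝ} (ht : t ∈ I)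
    (hreg : Regular S D (v t) t) {k : ℕ} (hk : k + 1 < n) :
    HasDerivWithinAt (fun r => eps S D (k + 1) (v r) r)
      (S.g (k + 2) ((v t).upTo (k + 2)) (epsNext S D (k + 2) (v t) t)
        + ∑ j : Fin n with j.val + 1 < k + 2, (dZ (tau S D 0 (k + 1)) (v t) t j
            ((v t).dHat D (j + 1) (n - (j + 1)) - d (j + 1) t)
          - (((n : ℝ) - ((j : ℝ) + 1) + 1) / (4 * D.γ (j + 1))
              * frobSq (dZ (tau S D 0 (k + 1)) (v t) t j)) • eps S D (k + 1) (v t) t)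
        + (d (k + 2) t - (v t).dHat D (k + 2) (n - (k + 2)))
        - (((n : ℝ) - ((k : ℝ) + 2) + 1) / (4 * D.margin n (k + 2))) • eps S D (k + 1) (v t) t
        - D.k (k + 2) • eps S D (k + 1) (v t) t
        - ContinuousLinearMap.adjoint (S.g (k + 1) ((v t).upTo (k + 1))) (lVec S D k (v t) t))
      I t := by
  have h1 := hv.hasDerivWithinAt_Z ht hk
  have h2 := tau_hasDerivWithinAt hS hρ hv ht hreg 0 hk
  refine (h1.sub h2).congr_deriv ?_
  rw [map_add, tau, apply_rightInv (hreg.invertible (k + 2) (by omega) hk),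
    tau_proxy_irrel S D _ 0 (k + 1) hk, tau_proxy_irrel S D _ 0 k (by omega)]
  simp only [map_sub, Finset.sum_sub_distrib]
  change _ = _ - ContinuousLinearMap.adjoint (S.g (k + 1) ((v t).upTo (k + 1)))
    (if k = 0 then (1 / (D.ρ t ^ 2 - ‖(v t).Z (k + 1) - tau S D 0 k (v t) t‖ ^ 2)) •
      ((v t).Z (k + 1) - tau S D 0 k (v t) t) else (v t).Z (k + 1) - tau S D 0 k (v t) t)
  simp only [eps, Nat.add_assoc, Nat.reduceAdd]
  abel

end Lyapunov

/-! ### Decay of the Lyapunov function -/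

section LyapunovDecay

variable {n : ℕ} {p : ℕ → ℕ}

theorem Design.TrackingGains.margin_pos {D : Design} (hD : D.TrackingGains n) {k : ℕ}
    (hk : 1 ≤ k) (hkn : k ≤ n) : 0 < D.margin n k := by
  obtain ⟨-, -, h3, -, -, -, h6⟩ := hD
  by_cases h : k = n
  · rw [Design.margin, if_pos h]; linarith
  · rw [Design.margin, if_neg h]
    have := (h3 k hk (by omega)).2.2
    linarith

/-- Barrier level: the term `ρ̇/ρ e` in `τ_1` cancels the motion of the bound `ρ`. -/
theorem lyap_zero_le {S : Plant p} {D : Design} (hn : 0 < n) (hρ : ContDiff ℝ ∞ D.ρ)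
    (hD : D.TrackingGains n) {ν : State n p × ℝ → Vec (p 1)} {d : (k : ℕ) → ℝ → Vec (p k)}
    {I : Set ℝ} {v : ℝ → State n p} (hv : IsClosedLoop S D ν d I v) {t : ℝ} (ht : t ∈ I)
    (hreg : Regular S D (v t) t) (hρt : 0 < D.ρ t) (hgap : 0 < D.ρ t ^ 2 - ‖(v t).err‖ ^ 2)
    {M : ℝ} (hM : ‖d 1 t - (v t).dHat D 1 (n - 1)‖ ≤ M) :
    ∃ W', HasDerivWithinAt (fun r => lyap S D 0 (v r) r) W' I t ∧
      W' ≤ coupling S D 1 (v t) t - coupling S D 0 (v t) t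
        + M ^ 2 / (4 * (n / (4 * D.margin n 1))) := by
  have he := err_hasDerivWithinAt hn hv ht hreg
  set e := (v t).err with he0
  set δ := d 1 t - (v t).dHat D 1 (n - 1)
  set γ := S.g 1 ((v t).upTo 1) (epsNext S D 1 (v t) t) with hγ
  set G := D.ρ t ^ 2 - ‖e‖ ^ 2 with hG
  have hρd : HasDerivWithinAt D.ρ (deriv D.ρ t) I t :=
    ((hρ.differentiable (by simp)) t).hasDerivAt.hasDerivWithinAt
  have hlog1 := hρd.log hρt.ne'
  have hgapd : HasDerivWithinAt (fun r => D.ρ r ^ 2 - ‖(v r).err‖ ^ 2) _ I t :=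
    (hρd.pow 2).sub he.norm_sq
  have hlog2 := hgapd.log hgap.ne'
  refine ⟨_, hlog1.sub (hlog2.const_mul (1 / 2)), ?_⟩
  have hm := hD.margin_pos le_rfl hn
  have hk1 := (hD.1 1 le_rfl hn).2
  have hn' : (0 : ℝ) < n := by exact_mod_cast hn
  have hc : 0 < (n : ℝ) / (4 * D.margin n 1) := by positivity
  have hy := inner_le_young ((1 / G) • e) δ hc hM
  have hcoup : coupling S D 1 (v t) t = inner ℝ e γ / G := by
    show inner ℝ γ ((1 / G) • e) = _
    rw [inner_smul_right, real_inner_comm]; ring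
  rw [hcoup]
  simp only [coupling, ← he0, ← hG, sub_zero]
  rw [norm_smul, mul_pow, inner_smul_left] at hy
  simp only [inner_add_right, inner_sub_right, inner_smul_right, real_inner_self_eq_norm_sq]
  simp only [Real.norm_eq_abs, sq_abs, conj_trivial] at hy
  set c := (n : ℝ) / (4 * D.margin n 1) with hcdef
  have hcG : (n : ℝ) / (4 * D.margin n 1 * G) = c / G := by rw [hcdef]; field_simp
  rw [hcG]
  set E := ‖e‖ ^ 2 with hE
  have hE0 : 0 ≤ E := sq_nonneg _
  have hkE : 0 ≤ D.k 1 * E / G := by positivity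
  have key : deriv D.ρ t / D.ρ t - 1 / 2 * ((((2 : ℕ) : ℝ) * D.ρ t ^ (2 - 1) * deriv D.ρ t
      - 2 * (deriv D.ρ t / D.ρ t * E - D.k 1 * E - c / G * E + inner ℝ e γ + inner ℝ e δ)) / G)
      = inner ℝ e γ / G + (1 / G * inner ℝ e δ - c * ((1 / G) ^ 2 * E)) - D.k 1 * E / G := by
    have hρ2 : D.ρ t ^ 2 = G + E := by rw [hG]; ring
    have hG' : G ≠ 0 := hgap.ne'
    have hρ' : D.ρ t ≠ 0 := hρt.ne'
    field_simp
    push_cast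
    simp only [pow_one]
    linear_combination (-2 * deriv D.ρ t * G) * hρ2
  rw [key]
  linarith

/-- Backstepping levels: the coupling with the previous level is cancelled by `-g_{k+1}ᵀ l_{k+2}`
and the disturbance estimates are dominated by the damping terms. -/
theorem lyap_succ_le {S : Plant p} {D : Design} (hS : S.IsSmooth n) (hρ : ContDiff ℝ ∞ D.ρ)
    (hD : D.TrackingGains n) {ν : State n p × ℝ → Vec (p 1)} {d : (k : ℕ) → ℝ → Vec (p k)}
    {I : Set ℝ} {v : ℝ → State n p} (hv : IsClosedLoop S D ν d I v) {t : ℝ} (ht : t ∈ I)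
    (hreg : Regular S D (v t) t) {k : ℕ} (hk : k + 1 < n)
    {M : ℝ} (hM : ∀ j, 1 ≤ j → j ≤ n → ‖d j t - (v t).dHat D j (n - j)‖ ≤ M) :
    ∃ W', HasDerivWithinAt (fun r => lyap S D (k + 1) (v r) r) W' I t ∧
      W' ≤ coupling S D (k + 2) (v t) t - coupling S D (k + 1) (v t) t
        + (∑ j : Fin n with j.val + 1 < k + 2,
            M ^ 2 / (4 * (((n : ℝ) - ((j : ℝ) + 1) + 1) / (4 * D.γ (j + 1))))
          + M ^ 2 / (4 * (((n : ℝ) - ((k : ℝ) + 2) + 1) / (4 * D.margin n (k + 2))))) := by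
  have he := (eps_hasDerivWithinAt hS hρ hv ht hreg hk).norm_sq.const_mul (1 / 2)
  refine ⟨_, he, ?_⟩
  set ε := eps S D (k + 1) (v t) t with hε
  have hm := hD.margin_pos (show 1 ≤ k + 2 by omega) (show k + 2 ≤ n by omega)
  have hkk := (hD.1 (k + 2) (by omega) (by omega)).2
  have hkn : ((k : ℝ) + 2) ≤ n := by exact_mod_cast (show k + 2 ≤ n by omega)
  have hc : 0 < ((n : ℝ) - ((k : ℝ) + 2) + 1) / (4 * D.margin n (k + 2)) :=
    div_pos (by linarith) (by positivity)
  have hy := inner_le_young ε _ hc (hM (k + 2) (by omega) (by omega))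
  have hsum : ∑ j : Fin n with j.val + 1 < k + 2, (inner ℝ ε (dZ (tau S D 0 (k + 1)) (v t) t j
            ((v t).dHat D (j + 1) (n - (j + 1)) - d (j + 1) t))
          - (((n : ℝ) - ((j : ℝ) + 1) + 1) / (4 * D.γ (j + 1))
              * frobSq (dZ (tau S D 0 (k + 1)) (v t) t j)) * ‖ε‖ ^ 2)
      ≤ ∑ j : Fin n with j.val + 1 < k + 2,
            M ^ 2 / (4 * (((n : ℝ) - ((j : ℝ) + 1) + 1) / (4 * D.γ (j + 1)))) := by
    refine Finset.sum_le_sum fun j hj => ?_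
    have hj' : j.val + 1 < k + 2 := by simpa using hj
    have hγ := (hD.2.2.1 (j + 1) (by omega) (by omega)).1
    have hjn : ((j : ℝ) + 1) ≤ n := by exact_mod_cast j.isLt
    have hcj : 0 < ((n : ℝ) - ((j : ℝ) + 1) + 1) / (4 * D.γ (j + 1)) :=
      div_pos (by linarith) (by positivity)
    have h1 := hM (j + 1) (by omega) (by omega)
    rw [norm_sub_rev] at h1
    have := inner_apply_le_young (dZ (tau S D 0 (k + 1)) (v t) t j) ε _ hcj h1
    linarith
  have hcoup : coupling S D (k + 2) (v t) t
      = inner ℝ ε (S.g (k + 2) ((v t).upTo (k + 2)) (epsNext S D (k + 2) (v t) t)) := by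
    show inner ℝ _ (lVec S D (k + 1) (v t) t) = _
    rw [lVec, if_neg (by omega), real_inner_comm]
  have hcoup' : coupling S D (k + 1) (v t) t = inner ℝ ε
      (ContinuousLinearMap.adjoint (S.g (k + 1) ((v t).upTo (k + 1))) (lVec S D k (v t) t)) := by
    rw [coupling, epsNext, if_pos hk, ContinuousLinearMap.adjoint_inner_right]
  rw [hcoup, hcoup']
  simp only [inner_add_right, inner_sub_right, inner_smul_right, inner_sum,
    real_inner_self_eq_norm_sq]
  have hkE : 0 ≤ D.k (k + 2) * ‖ε‖ ^ 2 := by positivity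
  simp only [inner_sub_right] at hy
  linarith

end LyapunovDecay

/-! ### Continuation argument -/

section Closing

variable {n : ℕ} {p : ℕ → ℕ} {S : Plant p} {D : Design} {ν : State n p × ℝ → Vec (p 1)}
  {d : (k : ℕ) → ℝ → Vec (p k)} {v : ℝ → State n p}

theorem IsClosedLoop.mono {I J : Set ℝ} (hv : IsClosedLoop S D ν d I v) (hJ : J ⊆ I) :
    IsClosedLoop S D ν d J v where
  x_eq t ht := (hv.x_eq t (hJ ht)).mono hJ
  z_eq t ht i := (hv.z_eq t (hJ ht) i).mono hJ
  mu_eq t ht i := (hv.mu_eq t (hJ ht) i).mono hJ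
  s_eq t ht i := (hv.s_eq t (hJ ht) i).mono hJ
  filt_eq t ht i j := (hv.filt_eq t (hJ ht) i j).mono hJ
  mu_init := hv.mu_init

theorem IsClosedLoop.continuousOn {I : Set ℝ} (hv : IsClosedLoop S D ν d I v) :
    ContinuousOn v I :=
  ContinuousOn.prodMk (fun t ht => (hv.x_eq t ht).continuousWithinAt) <|
  ContinuousOn.prodMk (continuousOn_pi.2 fun i t ht => (hv.z_eq t ht i).continuousWithinAt) <|
  ContinuousOn.prodMk (continuousOn_pi.2 fun i t ht => (hv.mu_eq t ht i).continuousWithinAt) <|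
  ContinuousOn.prodMk (continuousOn_pi.2 fun i t ht => (hv.s_eq t ht i).continuousWithinAt) <|
  continuousOn_pi.2 fun i => continuousOn_pi.2 fun j t ht =>
    (hv.filt_eq t ht i j).continuousWithinAt

theorem IsClosedLoop.err_zero {I : Set ℝ} (hv : IsClosedLoop S D ν d I v) (hn : 0 < n) :
    (v 0).err = 0 := by
  rw [State.err, nth_of_lt _ hn, hv.mu_init, if_pos rfl, sub_self]

theorem regular_of_safe (hg : S.HasRightInverses n) {u : State n p} {t : ℝ} (hρt : 0 < D.ρ t)
    (he : ‖u.err‖ < D.ρ t) (hx : u.x ∈ S.safeSet) : Regular S D u t where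
  rho_ne := hρt.ne'
  gap_ne := by
    have := pow_lt_pow_left₀ he (norm_nonneg _) two_ne_zero
    linarith
  invertible k h1 h2 := isInvertible_comp_adjoint (hg k h1 h2 (u.upTo k) hx)

theorem coupling_last (hn : 0 < n) (u : State n p) (t : ℝ) : coupling S D n u t = 0 := by
  obtain ⟨m, rfl⟩ : ∃ m, n = m + 1 := ⟨n - 1, by omega⟩
  rw [coupling, epsNext, if_neg (lt_irrefl _), map_zero, inner_zero_left]

/-- On a compact time interval the errors of the disturbance estimates are bounded, simply because
all signals are continuous. -/
theorem exists_estimate_bound {t₁ : ℝ} (hv : IsClosedLoop S D ν d (Set.Icc 0 t₁) v)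
    (hd : ∀ k, 1 ≤ k → k ≤ n → ContinuousOn (d k) (Set.Icc 0 t₁)) :
    ∃ M, ∀ t ∈ Set.Icc 0 t₁, ∀ k, 1 ≤ k → k ≤ n → ‖d k t - (v t).dHat D k (n - k)‖ ≤ M := by
  have h : ∀ k, ∃ B, 1 ≤ k → k ≤ n → ∀ t ∈ Set.Icc 0 t₁, ‖d k t - (v t).dHat D k (n - k)‖ ≤ B := by
    intro k
    by_cases hk : 1 ≤ k ∧ k ≤ n
    · have hc : ContinuousOn (fun t => d k t - (v t).dHat D k (n - k)) (Set.Icc 0 t₁) :=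
        (hd k hk.1 hk.2).sub
          ((State.contDiff_dHat (k := 0) D k (n - k)).continuous.comp_continuousOn hv.continuousOn)
      obtain ⟨B, hB⟩ := isCompact_Icc.exists_bound_of_continuousOn hc
      exact ⟨B, fun _ _ => hB⟩
    · exact ⟨0, fun h1 h2 => absurd ⟨h1, h2⟩ hk⟩
  choose B hB using h
  refine ⟨∑ k ∈ Finset.Icc 1 n, |B k|, fun t ht k h1 h2 => ((hB k h1 h2 t ht).trans
    (le_abs_self _)).trans ?_⟩
  exact Finset.single_le_sum (f := fun k => |B k|) (fun i _ => abs_nonneg _)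
    (Finset.mem_Icc.2 ⟨h1, h2⟩)

/-- The tracking error cannot reach the performance bound while `x` is safe: on `[0, t₁)` the
Lyapunov function grows at most linearly, so `ρ² - ‖e‖²` stays away from zero up to `t₁`. -/
theorem err_lt_at_end (hn : 0 < n) (hS : S.IsSmooth n) (hg : S.HasRightInverses n)
    (hρ : D.PerformanceBound n) (hD : D.TrackingGains n) {t₁ : ℝ} (ht₁ : 0 < t₁)
    (hv : IsClosedLoop S D ν d (Set.Icc 0 t₁) v)
    (hd : ∀ k, 1 ≤ k → k ≤ n → ContinuousOn (d k) (Set.Icc 0 t₁))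
    (hgood : ∀ t ∈ Set.Ico 0 t₁, ‖(v t).err‖ < D.ρ t ∧ 0 < S.h (v t).x) :
    ‖(v t₁).err‖ < D.ρ t₁ := by
  obtain ⟨M, hM⟩ := exists_estimate_bound hv hd
  have hv' := hv.mono Set.Ico_subset_Icc_self
  have hgap : ∀ t ∈ Set.Ico 0 t₁, 0 < D.ρ t ^ 2 - ‖(v t).err‖ ^ 2 := fun t ht => by
    have := pow_lt_pow_left₀ (hgood t ht).1 (norm_nonneg _) two_ne_zero
    linarith
  have hreg : ∀ t ∈ Set.Ico 0 t₁, Regular S D (v t) t := fun t ht =>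
    regular_of_safe hg (hρ.2.1 t ht.1) (hgood t ht).1 (hgood t ht).2.le
  have hlev : ∀ k, ∃ K, k < n → ∀ t ∈ Set.Ico 0 t₁, ∃ W',
      HasDerivWithinAt (fun r => lyap S D k (v r) r) W' (Set.Ico 0 t₁) t ∧
      W' ≤ coupling S D (k + 1) (v t) t - coupling S D k (v t) t + K := by
    rintro (_ | k)
    · exact ⟨_, fun _ t ht => lyap_zero_le hn hρ.1 hD hv' ht (hreg t ht) (hρ.2.1 t ht.1)
        (hgap t ht) (hM t (Set.Ico_subset_Icc_self ht) 1 le_rfl hn)⟩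
    · exact ⟨_, fun hk t ht => lyap_succ_le hS hρ.1 hD hv' ht (hreg t ht) hk
        (hM t (Set.Ico_subset_Icc_self ht))⟩
  choose K hK using hlev
  choose! W' hW' using hK
  set Kt := ∑ k ∈ Finset.range n, K k with hKt
  set W : ℝ → ℝ := fun t => ∑ k ∈ Finset.range n, lyap S D k (v t) t with hWdef
  have hWd : ∀ t ∈ Set.Ico 0 t₁, HasDerivWithinAt (fun t => W t - Kt * t)
      (∑ k ∈ Finset.range n, W' k t - Kt * 1) (Set.Ico 0 t₁) t := fun t ht =>
    (HasDerivWithinAt.fun_sum fun k hk => (hW' k (Finset.mem_range.1 hk) t ht).1).sub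
      ((hasDerivWithinAt_id t _).const_mul Kt)
  have hanti : AntitoneOn (fun t => W t - Kt * t) (Set.Ico 0 t₁) := by
    refine antitoneOn_of_hasDerivWithinAt_nonpos (convex_Ico 0 t₁)
      (fun t ht => (hWd t ht).continuousWithinAt)
      (fun t ht => (hWd t (interior_subset ht)).mono interior_subset) fun t ht => ?_
    have h1 : ∑ k ∈ Finset.range n, W' k t ≤ ∑ k ∈ Finset.range n,
        (coupling S D (k + 1) (v t) t - coupling S D k (v t) t + K k) :=
      Finset.sum_le_sum fun k hk => (hW' k (Finset.mem_range.1 hk) t (interior_subset ht)).2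
    rw [Finset.sum_add_distrib, Finset.sum_range_sub (fun k => coupling S D k (v t) t),
      coupling_last hn] at h1
    simp only [coupling] at h1
    linarith
  set C := W 0 + |Kt| * t₁ with hC
  have hlyap : ∀ t ∈ Set.Ico 0 t₁, lyap S D 0 (v t) t ≤ C := fun t ht => by
    have h1 := hanti (Set.left_mem_Ico.2 ht₁) ht ht.1
    have h2 : lyap S D 0 (v t) t ≤ W t := by
      have h3 : ∑ k ∈ Finset.range n, lyap S D k (v t) t
          = ∑ k ∈ Finset.range (n - 1), lyap S D (k + 1) (v t) t + lyap S D 0 (v t) t := by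
        rw [← Finset.sum_range_succ' (fun k => lyap S D k (v t) t), Nat.sub_add_cancel hn]
      have h4 : 0 ≤ ∑ k ∈ Finset.range (n - 1), lyap S D (k + 1) (v t) t :=
        Finset.sum_nonneg fun k _ => by simp only [lyap]; positivity
      simp only [hWdef]
      linarith
    have h5 : Kt * t ≤ |Kt| * t₁ :=
      (mul_le_mul_of_nonneg_right (le_abs_self Kt) ht.1).trans
        (mul_le_mul_of_nonneg_left ht.2.le (abs_nonneg _))
    simp only [mul_zero, sub_zero] at h1
    linarith
  have hlow : ∀ t ∈ Set.Ico 0 t₁,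
      Real.exp (-2 * C) * D.ρ t ^ 2 ≤ D.ρ t ^ 2 - ‖(v t).err‖ ^ 2 := fun t ht => by
    have h1 := hlyap t ht
    have hρt := hρ.2.1 t ht.1
    simp only [lyap] at h1
    rw [← Real.log_le_log_iff (by positivity) (hgap t ht), Real.log_mul (Real.exp_pos _).ne'
      (by positivity), Real.log_exp, Real.log_pow]
    push_cast
    linarith
  have hρc : Continuous D.ρ := hρ.1.continuous
  have herrc : ContinuousOn (fun t => (v t).err) (Set.Icc 0 t₁) :=
    (State.contDiff_err (k := 0)).continuous.comp_continuousOn hv.continuousOn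
  have hcl : t₁ ∈ closure (Set.Ico 0 t₁) := by
    rw [closure_Ico ht₁.ne]; exact Set.right_mem_Icc.2 ht₁.le
  have hend : Real.exp (-2 * C) * D.ρ t₁ ^ 2 ≤ D.ρ t₁ ^ 2 - ‖(v t₁).err‖ ^ 2 := by
    have hR : ContinuousWithinAt (fun t => D.ρ t ^ 2 - ‖(v t).err‖ ^ 2) (Set.Ico 0 t₁) t₁ :=
      (((hρc.pow 2).continuousOn.sub (herrc.norm.pow 2)) t₁
        (Set.right_mem_Icc.2 ht₁.le)).mono Set.Ico_subset_Icc_self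
    exact ContinuousWithinAt.closure_le hcl
      ((continuous_const.mul (hρc.pow 2)).continuousWithinAt) hR hlow
  have hρ1 := hρ.2.1 t₁ ht₁.le
  have h6 : 0 < Real.exp (-2 * C) * D.ρ t₁ ^ 2 := by positivity
  exact lt_of_pow_lt_pow_left₀ 2 hρ1.le (by linarith)

theorem Design.Saturation.pos_of_yVal_pos (hχ : D.Saturation n) (hξ : 0 < D.ξ) {x : Vec (p 0)}
    (h : 0 < yVal n S D x 0) : 0 < S.h x := by
  have h1 : 0 < D.χ (S.h x / D.ξ) := by simpa [yVal] using h
  have h2 := hχ.pos_of_pos h1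
  exact (div_pos_iff_of_pos_right hξ).1 h2

/-- The state stays safe as long as the tracking error respects the performance bound. -/
theorem safe_at_end (hn : 0 < n) (hS : S.IsSmooth n) (hρ : D.PerformanceBound n)
    (hχ : D.Saturation n) {ν_d : State n p × ℝ → Vec (p 1)} (hQP : SolvesQP S D ν ν_d)
    {t₁ : ℝ} (ht₁ : 0 ≤ t₁) (hv : IsClosedLoop S D ν d (Set.Icc 0 t₁) v)
    (hproxy : ProxyConditions n S D (v 0).x (v 0).mu)
    (hgood : ∀ t ∈ Set.Ico 0 t₁, ‖(v t).err‖ < D.ρ t ∧ 0 < S.h (v t).x) :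
    0 < S.h (v t₁).x := by
  refine hχ.pos_of_yVal_pos hproxy.xi_pos ?_
  refine bFun_pos (x := fun t => (v t).x) (μ := fun t => (v t).mu) (e := fun t => (v t).err)
    (w := fun t => ν (v t, t)) hn hS hρ.1 hχ hproxy.beta_pos ht₁ (fun t ht => ?_)
    (fun t ht j => ?_) (fun t ht => (hgood t (Set.Ioo_subset_Ico_self ht)).1.le)
    (fun t ht => (hQP (v t) t (hgood t (Set.Ioo_subset_Ico_self ht)).2.le ht.1.le).1)
    (fun i hi => ?_) 0 (Nat.zero_le n) t₁ (Set.right_mem_Icc.2 ht₁)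
  · have h1 : nth (v t).mu 0 + (v t).err = (v t).Z 1 := by rw [State.err]; abel
    rw [h1]
    exact hv.x_eq t ht
  · have h1 : (if j.val + 1 < n then nth (v t).mu (j + 1) else ν (v t, t))
        = (v t).chain (ν (v t, t)) (j + 1) := by
      by_cases h : j.val + 1 < n
      · rw [if_pos h, nth_of_lt _ h, State.chain, dif_pos h]
      · rw [if_neg h, State.chain, dif_neg h]
    rw [h1]
    exact hv.mu_eq t ht j
  · rcases Nat.eq_zero_or_pos i with rfl | h
    · exact hproxy.init_zero
    · exact hproxy.init i h hi

theorem Icc_subset_timeInterval {T : EReal} {t₁ : ℝ} (ht₁ : t₁ ∈ timeInterval T) :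
    Set.Icc 0 t₁ ⊆ timeInterval T := fun _ ht =>
  ⟨ht.1, lt_of_le_of_lt (EReal.coe_le_coe_iff.2 ht.2) ht₁.2⟩

end Closing

end PCBF

theorem theorem2 (n : ℕ) (hn : 2 ≤ n) (p : ℕ → ℕ) (S : PCBF.Plant p) (D : PCBF.Design)
    (hS : S.IsSmooth n) (hg : S.HasRightInverses n)
    (hρ : D.PerformanceBound n) (hχ : D.Saturation n) (hD : D.TrackingGains n)
    (ν ν_d : PCBF.State n p × ℝ → PCBF.Vec (p 1))
    (hν : LocallyLipschitzOn {q | q.1.x ∈ S.safeSet ∧ 0 ≤ q.2} ν)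
    (hQP : PCBF.SolvesQP S D ν ν_d)
    (T : EReal) (d : (k : ℕ) → ℝ → PCBF.Vec (p k))
    (hd : PCBF.BoundedRate n d (PCBF.timeInterval T))
    (v : ℝ → PCBF.State n p)
    (hv : PCBF.IsClosedLoop S D ν d (PCBF.timeInterval T) v)
    (hproxy : PCBF.ProxyConditions n S D (v 0).x (v 0).mu) :
    ∀ t ∈ PCBF.timeInterval T, ‖(v t).err‖ ≤ D.ρ t ∧ 0 ≤ S.h (v t).x := by
  intro t ht
  have hn0 : 0 < n := by omega
  have hsub := PCBF.Icc_subset_timeInterval ht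
  have hvc := (hv.mono hsub).continuousOn
  have hec : ContinuousOn (fun s => D.ρ s - ‖(v s).err‖) (Set.Icc 0 t) :=
    hρ.1.continuous.continuousOn.sub
      ((PCBF.State.contDiff_err (k := 0)).continuous.comp_continuousOn hvc).norm
  have hhc : ContinuousOn (fun s => S.h (v s).x) (Set.Icc 0 t) :=
    hS.2.2.1.continuous.comp_continuousOn (continuous_fst.comp_continuousOn hvc)
  -- `B` is the set of times at which one of the two strict inequalities fails; it is compact, so if
  -- it is nonempty it has a least element.
  let B : Set ℝ := {s ∈ Set.Icc 0 t | min (D.ρ s - ‖(v s).err‖) (S.h (v s).x) ≤ 0}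
  have hB : IsCompact B := by
    have : IsClosed B :=
      (hec.inf hhc).preimage_isClosed_of_isClosed isClosed_Icc isClosed_Iic
    exact isCompact_Icc.of_isClosed_subset this fun s hs => hs.1
  have hBempty : B = ∅ := by
    by_contra hne
    obtain ⟨t₁, ht₁, hmin⟩ := hB.exists_isLeast (Set.nonempty_iff_ne_empty.2 hne)
    have hgood : ∀ s ∈ Set.Ico 0 t₁, ‖(v s).err‖ < D.ρ s ∧ 0 < S.h (v s).x := by
      intro s hs
      have hsB : s ∉ B := fun h => absurd (hmin h) (not_le.2 hs.2)
      have h1 : 0 < min (D.ρ s - ‖(v s).err‖) (S.h (v s).x) := by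
        by_contra h
        exact hsB ⟨⟨hs.1, hs.2.le.trans ht₁.1.2⟩, not_lt.1 h⟩
      exact ⟨sub_pos.1 (lt_min_iff.1 h1).1, (lt_min_iff.1 h1).2⟩
    have hsub₁ : Set.Icc 0 t₁ ⊆ PCBF.timeInterval T :=
      PCBF.Icc_subset_timeInterval (hsub ht₁.1)
    have hv₁ := hv.mono hsub₁
    have h1 : ‖(v t₁).err‖ < D.ρ t₁ := by
      rcases ht₁.1.1.eq_or_lt with h0 | h0
      · rw [← h0, hv.err_zero hn0, norm_zero]
        exact hρ.2.1 0 le_rfl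
      · exact PCBF.err_lt_at_end hn0 hS hg hρ hD h0 hv₁
          (fun k hk1 hk2 => ((hd k hk1 hk2).1.continuousOn).mono hsub₁) hgood
    have h2 := PCBF.safe_at_end hn0 hS hρ hχ hQP ht₁.1.1 hv₁ hproxy hgood
    exact absurd ht₁.2 (not_le.2 (lt_min (sub_pos.2 h1) h2))
  have htB : t ∉ B := by rw [hBempty]; exact Set.notMem_empty t
  have h1 : 0 < min (D.ρ t - ‖(v t).err‖) (S.h (v t).x) := by
    by_contra h
    exact htB ⟨Set.right_mem_Icc.2 ht.1, not_lt.1 h⟩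
  exact ⟨(sub_pos.1 (lt_min_iff.1 h1).1).le, (lt_min_iff.1 h1).2.le⟩
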